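/- **Conventions.** Strings are finite sequences over an arbitrary alphabet $\Sigma$, with positions numbered from $1$; $S[p..q)=S[p]\cdots S[q-1]$, and $\overline{S}$ is the reverse of $S$. *LZ77.* A fragment $S[i..i+\ell)$ is a previous factor if $S[i..i+\ell)=S[i'..i'+\ell)$ for some $i'\in[1..i)$. The LZ77 factorization of $S$ splits $S$ from left to right into non-empty phrases, each being the longest previous factor starting at the current position $i$, or the single character $S[i]$ if there is no non-empty previous factor there. $\mathsf{LZ}(S)$ is the sequence of encoded phrases: $(i',\ell)$ with the smallest possible $i'$ for a previous factor, and the character itself otherwise; $|\mathsf{LZ}(S)|$ is the number of phrases. Let $\mu^*(S)=\max |\mathsf{LZ}(\overline{S[\ell..r)})|$ over all fragments $S[\ell..r)$ of $S$. *Contexts.* For $k\ge 1$ and $p\in[1..|S|]$, the context $C_k(S,p)$ is the longest prefix $S[p..q)$ of $S[p..|S|]$ with $\mu^*(S[p..q))\le k$, and the double context $C^2_k(S,p)$ is the longest prefix $S[p..q)$ of $S[p..|S|]$ such that $\mu^*(S[p..r))\le k$ and $\mu^*(S[r..q))\le k$ for some $r\in[p..q]$. A fragment $S[p..q)$ covers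 the positions $p,\dots,q-1$. *Walks.* $(s_t)_{t=1}^{m+1}$ is an $m$-step complete walk over $S$ if $s_1=1$, $s_{m+1}=|S|+1$ and $s_{t+1}\in\{s_t,s_t+1\}$ for $t\in[1..m]$. *Context encoding.* For integers $1\le t<v$ let $\mu(t,v)$ be the integer in $[t..v)$ divisible by the largest power of $2$. The context encoding $\mathsf{CE}_k(W)$ of an $m$-step complete walk $W=(s_t)_{t=1}^{m+1}$ over $S$ is the string of length $m$ defined as follows. Let $\bot=(\mathsf{LZ}(\varepsilon),0)$, $\mu_0=0$, $s_0=0$, and for $t\in[1..m]$ with $s_t\le|S|$ let $\mu_t=\mu(t,\min\{v\in[1..m+1]: s_v=s_t+|C_k(S,s_t)|\})$. An index $t\in[1..m]$ is stored if $s_t\le|S|$ and $\mu_t>\mu_{t-1}$. If $t$ is stored, then $\mathsf{CE}_k(W)[t]=(\mathsf{LZ}(\overline{C^2_k(S,s_t)}),\,s_t-s_u)$, where $u$ is the largest stored index smaller than $t$ ($u=0$ if there is none); otherwise $\mathsf{CE}_k(W)[t]=\bot$. *Alignments.* An alignment of $X,Y$ is a sequence $(x_t,y_t)_{t=1}^{n}$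 from $(1,1)$ to $(|X|+1,|Y|+1)$ with $(x_{t+1},y_{t+1})\in\{(x_t+1,y_t+1),(x_t+1,y_t),(x_t,y_t+1)\}$. The element $(x_t,y_t)$, $t<n$, is a match if $(x_{t+1},y_{t+1})=(x_t+1,y_t+1)$ and $X[x_t]=Y[y_t]$; all other elements, including the last one, are breakpoints. For an alignment $\mathcal A$, $\mathcal M(\mathcal A)$ and $\mathcal B(\mathcal A)$ are the sets of matches and breakpoints, $\mathsf{cost}(\mathcal A)$ is the number of $t\in[1..n)$ such that $(x_t,y_t)$ is not a match, and $\mathsf{width}(\mathcal A)=\max_t|x_t-y_t|$. The edit distance $\mathsf{ed}(X,Y)$ is the minimum cost of an alignment of $X,Y$. $\mathcal A$ is greedy if $X[x]\ne Y[y]$ for every $(x,y)\in\mathcal B(\mathcal A)$ with $x\le|X|$ and $y\le|Y|$; $\mathsf{GA}_k(X,Y)$ is the set of greedy alignments of $X,Y$ of cost at most $k$. The zip alignment of $m$-step complete walks $(x_t)$ over $X$ and $(y_t)$ over $Y$ is obtained from $(x_t,y_t)_{t=1}^{m+1}$ by removing repeated entries. Let $\mathcal B_X(\mathcal A)=\{x\in[1..|X|]:(x,y)\in\mathcal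 B(\mathcal A)\text{ for some }y\}$, and let $\Delta_X(\mathcal A,\mathcal A')$ be the set of $x\in[1..|X|]$ for which no $y$ satisfies $(x,y)\in\mathcal M(\mathcal A)\cap\mathcal M(\mathcal A')$. $\mathsf{hd}$ denotes the Hamming distance. **Lemma.** There is a constant $c>0$ such that the following holds. Let $W_X=(x_t)_{t=1}^{m+1}$ and $W_Y=(y_t)_{t=1}^{m+1}$ be $m$-step complete walks over strings $X,Y\in\Sigma^*$, let $\mathcal A_W$ be their zip alignment, let $k'$ be a positive integer, and suppose that $\mathcal A_W$ is greedy. Let $P_X$ be the set of positions $x\in[1..|X|]$ covered by $C^2_{k'}(X,x_t)$ for some $t\in[1..m]$ with $\bot\ne\mathsf{CE}_{k'}(W_X)[t]\ne\mathsf{CE}_{k'}(W_Y)[t]$. Then $\mathcal B_X(\mathcal A_W)\subseteq P_X$. Moreover, for every positive integer $k\ge\mathsf{ed}(X,Y)$ with $k'\ge\mathsf{width}(\mathcal A_W)+5k$: - every $\mathcal A\in\mathsf{GA}_k(X,Y)$ satisfies $\Delta_X(\mathcal A,\mathcal A_W)\subseteq P_X$; - if $m\ge 2$, then $\mathsf{hd}(\mathsf{CE}_{k'}(W_X),\mathsf{CE}_{k'}(W_Y))\le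 c\left(k+\tfrac1k\mathsf{cost}(\mathcal A_W)\right)\log m$. -/

import Mathlib

/-! Strings are lists over an alphabet `α`.  All positions in strings and all indices of walks
are numbered from `1`. -/

namespace WalkEnc

/-! ### Strings and the LZ77 representation -/

/-- The fragment `S[p .. q)` (for `1 ≤ p`); it is empty if `q ≤ p`. -/
def frag {α : Type*} (S : List α) (p q : ℕ) : List α := (S.drop (p - 1)).take (q - p)

/-- `X[p.1]` and `Y[p.2]` are characters of `X` and `Y`, and they are equal. -/
def SameChar {α : Type*} (X Y : List α) (p : ℕ × ℕ) : Prop :=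
  (1 ≤ p.1 ∧ p.1 ≤ X.length) ∧ (1 ≤ p.2 ∧ p.2 ≤ Y.length) ∧ X[p.1 - 1]? = Y[p.2 - 1]?

instance {α : Type*} [DecidableEq α] (X Y : List α) (p : ℕ × ℕ) : Decidable (SameChar X Y p) := by
  unfold SameChar; infer_instance

/-- `X[i .. i + ℓ)` is a fragment of `X` and a previous factor: it is equal to `X[i' .. i' + ℓ)`
for some `i' ∈ [1 .. i)`. -/
def IsPrevFactor {α : Type*} (X : List α) (i ℓ : ℕ) : Prop :=
  i + ℓ ≤ X.length + 1 ∧ ∃ i' ∈ Finset.Ico 1 i, frag X i' (i' + ℓ) = frag X i (i + ℓ)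

instance {α : Type*} [DecidableEq α] (X : List α) (i ℓ : ℕ) : Decidable (IsPrevFactor X i ℓ) := by
  unfold IsPrevFactor; infer_instance

/-- The length of the longest non-empty previous factor of `X` starting at position `i`,
and `0` if there is none. -/
def lpf {α : Type*} [DecidableEq α] (X : List α) (i : ℕ) : ℕ :=
  Nat.findGreatest (fun ℓ => IsPrevFactor X i ℓ) X.length

/-- The leftmost `i' ∈ [1 .. i)` with `X[i .. i + ℓ) = X[i' .. i' + ℓ)`. -/
def source {α : Type*} [DecidableEq α] (X : List α) (i ℓ : ℕ) : ℕ :=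
  ((Finset.Ico 1 i).filter (fun i' => frag X i' (i' + ℓ) = frag X i (i + ℓ))).min.untopD 0

/-- An encoded phrase: a single character, or a pair `(i', ℓ)` that refers to an earlier
occurrence starting at position `i'` of a phrase of length `ℓ`. -/
abbrev Phrase (α : Type*) := α ⊕ (ℕ × ℕ)

/-- The encoded phrases of the LZ77 factorization of `X` from position `i` (for `1 ≤ i`) on. -/
def lzFrom {α : Type*} [DecidableEq α] (X : List α) (i : ℕ) : List (Phrase α) :=
  if h : i - 1 < X.length then
    (if lpf X i = 0 then Sum.inl X[i - 1] else Sum.inr (source X i (lpf X i), lpf X i))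
      :: lzFrom X (i + max 1 (lpf X i))
  else []
termination_by X.length + 1 - i
decreasing_by omega

/-- The LZ77 representation `LZ(X)`; its length is the number of phrases. -/
def lz {α : Type*} [DecidableEq α] (X : List α) : List (Phrase α) := lzFrom X 1

/-- The maximum of `|LZ(reverse of S[l .. r))|` over all fragments `S[l .. r)` of `S`. -/
def maxLZrev {α : Type*} [DecidableEq α] (S : List α) : ℕ :=
  (Finset.Icc 1 (S.length + 1)).sup fun l =>
    (Finset.Icc l (S.length + 1)).sup fun r => (lz (frag S l r).reverse).length

/-! ### Contexts and double contexts -/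

/-- The length of the context of `S` at `p`: the longest prefix `S[p .. p + ℓ)` of
`S[p .. |S|]` whose `maxLZrev` is at most `k`. -/
def ctxLen {α : Type*} [DecidableEq α] (k : ℕ) (S : List α) (p : ℕ) : ℕ :=
  Nat.findGreatest
    (fun ℓ : ℕ => p + ℓ ≤ S.length + 1 ∧ maxLZrev (frag S p (p + ℓ)) ≤ k) S.length

/-- The length of the double context of `S` at `p`: the longest prefix `S[p .. p + ℓ)` of
`S[p .. |S|]` that splits into `S[p .. r)` and `S[r .. p + ℓ)`, both with `maxLZrev` at most `k`. -/
def dctxLen {α : Type*} [DecidableEq α] (k : ℕ) (S : List α) (p : ℕ) : ℕ :=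
  Nat.findGreatest
    (fun ℓ : ℕ => p + ℓ ≤ S.length + 1 ∧ ∃ r ∈ Finset.Icc p (p + ℓ),
      maxLZrev (frag S p r) ≤ k ∧ maxLZrev (frag S r (p + ℓ)) ≤ k) S.length

/-- The double context of `S` at `p`, as a string. -/
def dctx {α : Type*} [DecidableEq α] (k : ℕ) (S : List α) (p : ℕ) : List α :=
  frag S p (p + dctxLen k S p)

/-! ### Walks and the context encoding -/

/-- `s 1, …, s (m + 1)` is an `m`-step complete walk over `S`
(the values of `s` at other arguments are irrelevant). -/
def IsCompleteWalk {α : Type*} (m : ℕ) (S : List α) (s : ℕ → ℕ) : Prop :=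
  s 1 = 1 ∧ s (m + 1) = S.length + 1 ∧
    ∀ t ∈ Finset.Icc 1 m, s (t + 1) = s t ∨ s (t + 1) = s t + 1

/-- The element of `[t .. v)` that is divisible by the largest power of two
(for `1 ≤ t < v`, where it is unique). -/
def mu (t v : ℕ) : ℕ :=
  ((Finset.Ico t v).filter
    (fun w => ∀ w' ∈ Finset.Ico t v, padicValNat 2 w' ≤ padicValNat 2 w)).min.untopD 0

/-- The smallest `v ∈ [1 .. m + 1]` with `s v = q`. -/
def firstHit (m : ℕ) (s : ℕ → ℕ) (q : ℕ) : ℕ :=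
  ((Finset.Icc 1 (m + 1)).filter (fun v => s v = q)).min.untopD 0

/-- The number `μ_t` of the context encoding, with `μ_0 = 0`. -/
def muAt {α : Type*} [DecidableEq α] (k : ℕ) (S : List α) (m : ℕ) (s : ℕ → ℕ) (t : ℕ) : ℕ :=
  if t = 0 then 0 else mu t (firstHit m s (s t + ctxLen k S (s t)))

/-- A non-blank entry is stored at index `t`. -/
def Stored {α : Type*} [DecidableEq α] (k : ℕ) (S : List α) (m : ℕ) (s : ℕ → ℕ) (t : ℕ) : Prop :=
  1 ≤ t ∧ s t ≤ S.length ∧ muAt k S m s (t - 1) < muAt k S m s t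

instance {α : Type*} [DecidableEq α] (k : ℕ) (S : List α) (m : ℕ) (s : ℕ → ℕ) (t : ℕ) :
    Decidable (Stored k S m s t) := by
  unfold Stored; infer_instance

/-- The largest index `u < t` at which a non-blank entry is stored, and `0` if there is none. -/
def lastStored {α : Type*} [DecidableEq α] (k : ℕ) (S : List α) (m : ℕ) (s : ℕ → ℕ) (t : ℕ) : ℕ :=
  Nat.findGreatest (fun u => Stored k S m s u) (t - 1)

/-- The symbols of a context encoding. -/
abbrev Symbol (α : Type*) := List (Phrase α) × ℕ

/-- The blank symbol `(LZ(ε), 0)`. -/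
def blank {α : Type*} [DecidableEq α] : Symbol α := (lz ([] : List α), 0)

/-- The context encoding of the walk `s 1, …, s (m + 1)` over `S`, a string of `m` symbols.
The entry of index `t ∈ [1 .. m]` stands at `t - 1 : Fin m`.  At a stored index it is
`(LZ(reverse of the double context at s t), s t - s u)`, where `u` is the previous stored index,
with `u = 0` and `s 0 = 0` if there is none. -/
def contextEncoding {α : Type*} [DecidableEq α] (k : ℕ) (S : List α) (m : ℕ) (s : ℕ → ℕ) :
    Fin m → Symbol α := fun j =>
  let t : ℕ := j + 1
  let u : ℕ := lastStored k S m s t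
  if Stored k S m s t then
    (lz (dctx k S (s t)).reverse, s t - (if u = 0 then 0 else s u))
  else blank

/-! ### Alignments -/

/-- The steps of alignments. -/
def AlignStep (p q : ℕ × ℕ) : Prop :=
  q = (p.1 + 1, p.2 + 1) ∨ q = (p.1 + 1, p.2) ∨ q = (p.1, p.2 + 1)

/-- `A` is an alignment of `X` and `Y`. -/
def IsAlignment {α : Type*} (X Y : List α) (A : List (ℕ × ℕ)) : Prop :=
  A.head? = some (1, 1) ∧ A.getLast? = some (X.length + 1, Y.length + 1) ∧ A.IsChain AlignStep

/-- The step from `p` to `q` matches two equal characters. -/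
def IsMatchStep {α : Type*} (X Y : List α) (p q : ℕ × ℕ) : Prop :=
  q = (p.1 + 1, p.2 + 1) ∧ SameChar X Y p

instance {α : Type*} [DecidableEq α] (X Y : List α) (p q : ℕ × ℕ) :
    Decidable (IsMatchStep X Y p q) := by
  unfold IsMatchStep; infer_instance

/-- The cost of an alignment: the number of its steps that are deletions (of a character of `X`
or of `Y`) or substitutions. -/
def cost {α : Type*} [DecidableEq α] (X Y : List α) (A : List (ℕ × ℕ)) : ℕ :=
  (A.zip A.tail).countP fun e => ¬ IsMatchStep X Y e.1 e.2

/-- The edit distance of `X` and `Y`: the minimum cost of an alignment of `X` and `Y`. -/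
noncomputable def editDist {α : Type*} [DecidableEq α] (X Y : List α) : ℕ :=
  sInf {n | ∃ A, IsAlignment X Y A ∧ cost X Y A = n}

/-- The width of an alignment: the maximum of `|x - y|` over its elements `(x, y)`. -/
def width (A : List (ℕ × ℕ)) : ℕ :=
  A.toFinset.sup fun p => ((p.1 : ℤ) - (p.2 : ℤ)).natAbs

/-- The set of matches of an alignment. -/
def matchSet {α : Type*} (X Y : List α) (A : List (ℕ × ℕ)) : Set (ℕ × ℕ) :=
  {p | ∃ q, (p, q) ∈ A.zip A.tail ∧ IsMatchStep X Y p q}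

/-- The set of breakpoints of an alignment: all its elements other than matches. -/
def breakSet {α : Type*} (X Y : List α) (A : List (ℕ × ℕ)) : Set (ℕ × ℕ) :=
  {p | p ∈ A ∧ p ∉ matchSet X Y A}

/-- The alignment `A` is greedy. -/
def IsGreedy {α : Type*} (X Y : List α) (A : List (ℕ × ℕ)) : Prop :=
  ∀ p ∈ breakSet X Y A, ¬ SameChar X Y p

/-- The set of all greedy alignments of `X` and `Y` of cost at most `k`. -/
def greedyAlignments {α : Type*} [DecidableEq α] (k : ℕ) (X Y : List α) :
    Set (List (ℕ × ℕ)) :=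
  {A | IsAlignment X Y A ∧ IsGreedy X Y A ∧ cost X Y A ≤ k}

/-- The zip alignment of two `m`-step walks. -/
def zipAlignment (m : ℕ) (x y : ℕ → ℕ) : List (ℕ × ℕ) :=
  ((List.range' 1 (m + 1)).map fun t => (x t, y t)).dedup

/-- The positions of `X` that are involved in breakpoints of `A`. -/
def breakPositions {α : Type*} (X Y : List α) (A : List (ℕ × ℕ)) : Set ℕ :=
  {i | (1 ≤ i ∧ i ≤ X.length) ∧ ∃ j, (i, j) ∈ breakSet X Y A}

/-- The positions of `X` at which `A` and `A'` have no common match. -/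
def divergence {α : Type*} (X Y : List α) (A A' : List (ℕ × ℕ)) : Set ℕ :=
  {i | (1 ≤ i ∧ i ≤ X.length) ∧ ¬ ∃ j, (i, j) ∈ matchSet X Y A ∩ matchSet X Y A'}

/-- The positions of `X` that are covered by the double context of `X` at `x t` for some index
`t ∈ [1 .. m]` at which the context encoding of `x` is not blank and differs from that of `y`. -/
def revealed {α : Type*} [DecidableEq α] (k : ℕ) (X Y : List α) (m : ℕ) (x y : ℕ → ℕ) : Set ℕ :=
  {i | (1 ≤ i ∧ i ≤ X.length) ∧ ∃ j : Fin m,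
    contextEncoding k X m x j ≠ blank ∧
    contextEncoding k X m x j ≠ contextEncoding k Y m y j ∧
    x (j + 1) ≤ i ∧ i < x (j + 1) + dctxLen k X (x (j + 1))}

end WalkEnc

open WalkEnc

namespace WalkEnc

/-! ### Strings, LZ77 factorizations and contexts. -/

section Strings

variable {α : Type*}

/-! Call a fragment simple if all its reversed fragments have at most `k'` phrases; a context is a
maximal simple prefix. One estimate (`length_lz_le_of_above`) carries the proof. Suppose that over a
range of `X` one pair of walks stays strictly above another. Following a match of the upper pair
from `X[z]` to `Y[j]` and a match of the lower pair back from `Y[j]` to `X[z + d]` gives `X[z] = X[z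
+ d]` with `d > 0`. The offset `d` changes only at breaks, so reversed fragments of the range split
into few previous factors. Pairs without a common point cannot cross, so disjointness suffices
(`isSimple_of_disjoint`). If the zip alignment has width `w` and `b` breaks in the range, and the
other pair has at most `k` breaks, the bound is `w + 3k + 2b + 2`, which is at most `w + 5k ≤ k'`
whenever `b < k`.

Revealed positions: every index before the end of `X` lies in the context of some stored index. If
both encodings agreed at that index, injectivity of LZ77 would make the double contexts equal as
strings, and the greedy zip alignment would follow a diagonal through equal characters only. So a
point with unequal characters forces a difference, and the double context stored there covers the
whole context of that point (`exists_revealing_index`). When a greedy alignment of small cost misses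
a match of the zip alignment, tracing the zip alignment back to its last point with unequal
characters yields a range with disjoint walks and no breaks; this range is simple and hence lies in
the context of that last point.

Hamming distance: an encoded symbol depends only on a neighbourhood of its index, so a difference
needs a break of the zip alignment nearby (`contextSymbol_congr`). Compare with an alignment of cost
at most `k`. Either the neighbourhood contains one of at most `2k` events (shared breaks and
merges), or the two pairs are disjoint there, and maximality of the context forces at least `k`
breaks (`le_card_breaks_near`). Largest powers of two thin out the stored indices so that each index
lies in `O(log m)` neighbourhoods, and double counting finishes the proof. -/

theorem frag_getElem? (S : List α) (p q z : ℕ) :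
    (frag S p q)[z]? = if z < q - p then S[p - 1 + z]? else none := by
  simp only [frag, List.getElem?_take, List.getElem?_drop]

theorem frag_length {S : List α} {p q : ℕ} (hp : 1 ≤ p) (hq : q ≤ S.length + 1) :
    (frag S p q).length = q - p := by
  simp only [frag, List.length_take, List.length_drop]; omega

theorem frag_add_eq_iff {X Y : List α} {a b n : ℕ} :
    frag X a (a + n) = frag Y b (b + n) ↔ ∀ z < n, X[a - 1 + z]? = Y[b - 1 + z]? := by
  constructor
  · intro h z hz
    have := congrArg (fun l => l[z]?) h
    simpa [frag_getElem?, hz] using this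
  · intro h
    apply List.ext_getElem?
    intro z
    simp only [frag_getElem?, Nat.add_sub_cancel_left]
    split_ifs with hz
    · exact h z hz
    · rfl

theorem frag_frag {S : List α} {p q l r : ℕ} (hp : 1 ≤ p) (hl : 1 ≤ l) (hr : r ≤ q - p + 1) :
    frag (frag S p q) l r = frag S (p + l - 1) (p + r - 1) := by
  apply List.ext_getElem?
  intro z
  simp only [frag_getElem?]
  by_cases hz : z < r - l
  · rw [if_pos hz, if_pos (by omega), if_pos (by omega)]
    congr 1; omega
  · rw [if_neg hz, if_neg (by omega)]

theorem reverse_frag_getElem? {X : List α} {l r z : ℕ} (hl : 1 ≤ l) (hr : r ≤ X.length + 1)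
    (hz : z < r - l) : (frag X l r).reverse[z]? = X[r - 1 - z - 1]? := by
  rw [List.getElem?_reverse (by rw [frag_length hl hr]; exact hz), frag_length hl hr,
    frag_getElem?, if_pos (by omega)]
  congr 1; omega

variable [DecidableEq α]

theorem lpf_spec {X : List α} {i : ℕ} (h : lpf X i ≠ 0) : IsPrevFactor X i (lpf X i) :=
  Nat.findGreatest_of_ne_zero rfl h

theorem le_lpf {X : List α} {i n : ℕ} (hi : 1 ≤ i) (h : IsPrevFactor X i n) : n ≤ lpf X i :=
  Nat.le_findGreatest (by have := h.1; omega) h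

theorem source_spec {X : List α} {i n : ℕ} (h : IsPrevFactor X i n) :
    1 ≤ source X i n ∧ source X i n < i ∧
      frag X (source X i n) (source X i n + n) = frag X i (i + n) := by
  obtain ⟨-, i', hi', h⟩ := h
  have hne : ((Finset.Ico 1 i).filter
      (fun i' => frag X i' (i' + n) = frag X i (i + n))).Nonempty :=
    ⟨i', Finset.mem_filter.2 ⟨hi', h⟩⟩
  have hs : source X i n = Finset.min' _ hne := by
    rw [source, ← Finset.coe_min' hne]; rfl
  have := Finset.min'_mem _ hne
  rw [← hs, Finset.mem_filter, Finset.mem_Ico] at this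
  exact ⟨this.1.1, this.1.2, this.2⟩

theorem lzFrom_of_lt {X : List α} {i : ℕ} (h : i - 1 < X.length) :
    lzFrom X i = (if lpf X i = 0 then Sum.inl X[i - 1] else
      Sum.inr (source X i (lpf X i), lpf X i)) :: lzFrom X (i + max 1 (lpf X i)) := by
  rw [lzFrom, dif_pos h]

theorem lzFrom_of_le {X : List α} {i : ℕ} (h : X.length ≤ i - 1) : lzFrom X i = [] := by
  rw [lzFrom, dif_neg (by omega)]

/-- The LZ77 factorization has at most as many phrases as any factorization into single characters
and previous factors; `F` contains the starting positions of the latter, except for the first. -/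
theorem length_lzFrom_le {T : List α} {F : Finset ℕ}
    (hF : ∀ p q, 1 ≤ p → p < q → q ≤ T.length → (∀ z, p < z → z ≤ q → z ∉ F) →
      IsPrevFactor T p (q - p + 1)) (d : ℕ) :
    ∀ p, 1 ≤ p → p ≤ T.length → T.length - p ≤ d →
      (lzFrom T p).length ≤ 1 + (F.filter (fun z => p < z ∧ z ≤ T.length)).card := by
  induction d with
  | zero =>
    intro p h1 h2 h3
    rw [lzFrom_of_lt (by omega), List.length_cons, lzFrom_of_le (by omega)]
    simp
  | succ d ih =>
    intro p h1 h2 h3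
    rw [lzFrom_of_lt (by omega), List.length_cons]
    set q := p + max 1 (lpf T p) with hq
    by_cases hqn : q ≤ T.length
    · have h4 := ih q (by omega) hqn (by omega)
      -- The greedy phrase is maximal, so one more character must cross an element of `F`; that
      -- element is charged to the phrase.
      have : ∃ z, p < z ∧ z ≤ q ∧ z ∈ F := by
        by_contra hcon
        push Not at hcon
        have := le_lpf h1 (hF p q h1 (by omega) hqn hcon)
        omega
      obtain ⟨z, hz1, hz2, hz3⟩ := this
      have h5 : (F.filter (fun z => q < z ∧ z ≤ T.length)).card <
          (F.filter (fun z => p < z ∧ z ≤ T.length)).card := by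
        apply Finset.card_lt_card
        rw [Finset.ssubset_iff_of_subset]
        · refine ⟨z, ?_, ?_⟩
          · simp only [Finset.mem_filter]; exact ⟨hz3, hz1, by omega⟩
          · simp only [Finset.mem_filter]; omega
        · intro w
          simp only [Finset.mem_filter]
          rintro ⟨a, b, c⟩
          exact ⟨a, by omega, c⟩
      omega
    · rw [lzFrom_of_le (by omega)]
      simp

theorem length_lz_le {T : List α} : (lz T).length ≤ T.length := by
  by_cases h : T.length = 0
  · rw [lz, lzFrom_of_le (by omega)]; simp
  · have := length_lzFrom_le (T := T) (F := Finset.Icc 2 T.length) (by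
      intro p q h1 h2 h3 h4
      exact absurd (Finset.mem_Icc.2 ⟨by omega, h3⟩) (h4 q h2 le_rfl)) T.length 1 le_rfl (by omega)
      (by omega)
    have h2 : ((Finset.Icc 2 T.length).filter (fun z => 1 < z ∧ z ≤ T.length)).card ≤
      (Finset.Icc 2 T.length).card := Finset.card_filter_le _ _
    rw [Nat.card_Icc] at h2
    rw [lz]
    omega

/-- A bound on the number of phrases of a reversed fragment in terms of copies of its parts that
start further to the right. -/
theorem length_lz_reverse_frag_le {X : List α} {l r : ℕ} (hl : 1 ≤ l) (hr : r ≤ X.length + 1)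
    {F : Finset ℕ}
    (hF : ∀ i j, l ≤ i → i < j → j < r → (∀ z, i ≤ z → z < j → z ∉ F) →
      ∃ d, 0 < d ∧ j + d < r ∧ ∀ z, i ≤ z → z ≤ j → X[z - 1]? = X[z + d - 1]?) :
    (lz (frag X l r).reverse).length ≤ 1 + F.card := by
  have hlen : (frag X l r).reverse.length = r - l := by
    rw [List.length_reverse, frag_length hl hr]
  by_cases h : r ≤ l
  · rw [lz, lzFrom_of_le (by omega)]; simp
  -- Reversal sends position `i` to `r - i`, so a copy `d` further to the right becomes a previous
  -- factor starting `d` earlier.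
  have := length_lzFrom_le (T := (frag X l r).reverse) (F := F.image (fun i => r - i)) (by
    intro p q h1 h2 h3 h4
    rw [hlen] at h3
    obtain ⟨d, hd1, hd2, hd3⟩ := hF (r - q) (r - p) (by omega) (by omega) (by omega) (by
      intro z hz1 hz2 hz3
      exact h4 (r - z) (by omega) (by omega) (Finset.mem_image_of_mem _ hz3))
    refine ⟨by omega, p - d, Finset.mem_Ico.2 ⟨by omega, by omega⟩, ?_⟩
    rw [frag_add_eq_iff]
    intro z hz
    rw [reverse_frag_getElem? hl hr (by omega), reverse_frag_getElem? hl hr (by omega)]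
    have := hd3 (r - (p + z)) (by omega) (by omega)
    have e1 : r - 1 - (p - 1 + z) - 1 = r - (p + z) - 1 := by omega
    have e2 : r - 1 - (p - d - 1 + z) - 1 = r - (p + z) + d - 1 := by omega
    rw [e1, e2, this]) (r - l) 1 le_rfl (by omega) (by omega)
  refine this.trans (Nat.add_le_add_left ?_ _)
  exact (Finset.card_filter_le _ _).trans Finset.card_image_le

/-- Decoding of the LZ77 representation. -/
theorem eq_of_lzFrom_eq {X Y : List α} (d : ℕ) :
    ∀ i, 1 ≤ i → X.length + 1 - i ≤ d → (∀ z : ℕ, z < i - 1 → X[z]? = Y[z]?) →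
      lzFrom X i = lzFrom Y i → ∀ z : ℕ, X[z]? = Y[z]? := by
  induction d with
  | zero =>
    intro i h1 h2 h3 h4 z
    rw [lzFrom_of_le (by omega)] at h4
    by_cases h5 : i - 1 < Y.length
    · rw [lzFrom_of_lt h5] at h4; cases h4
    · by_cases hz : z < i - 1
      · exact h3 z hz
      · rw [List.getElem?_eq_none (by omega), List.getElem?_eq_none (by omega)]
  | succ d ih =>
    intro i h1 h2 h3 h4
    by_cases hX : i - 1 < X.length
    swap
    · exact ih i h1 (by omega) h3 h4
    by_cases hY : i - 1 < Y.length
    swap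
    · rw [lzFrom_of_lt hX, lzFrom_of_le (X := Y) (by omega)] at h4; cases h4
    rw [lzFrom_of_lt hX, lzFrom_of_lt hY, List.cons.injEq] at h4
    obtain ⟨h5, h6⟩ := h4
    have hl : lpf X i = lpf Y i := by
      split_ifs at h5 with ha hb hb
      · rw [ha, hb]
      · exact (Prod.mk.inj (Sum.inr.inj h5)).2
    rw [← hl] at h6 h5
    refine ih _ (by omega) (by omega) ?_ h6
    by_cases h0 : lpf X i = 0
    · rw [if_pos h0, if_pos h0, Sum.inl.injEq] at h5
      intro z hz
      by_cases hz' : z < i - 1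
      · exact h3 z hz'
      · have : z = i - 1 := by omega
        subst this
        rw [List.getElem?_eq_getElem hX, List.getElem?_eq_getElem hY, h5]
    · rw [if_neg h0, if_neg h0, Sum.inr.injEq, Prod.mk.injEq] at h5
      obtain ⟨a1, a2, a3⟩ := source_spec (lpf_spec h0)
      obtain ⟨b1, b2, b3⟩ := source_spec (lpf_spec (X := Y) (i := i) (by omega))
      rw [← hl, ← h5.1] at b1 b2 b3
      rw [frag_add_eq_iff] at a3 b3
      set s := source X i (lpf X i)
      set n := lpf X i
      -- A phrase may overlap its source, so it is decoded one character at a time.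
      have key : ∀ w, w ≤ n → ∀ z : ℕ, z < i - 1 + w → X[z]? = Y[z]? := by
        intro w
        induction w with
        | zero => intro _ z hz; exact h3 z hz
        | succ w ihw =>
          intro hw z hz
          by_cases hz' : z < i - 1 + w
          · exact ihw (by omega) z hz'
          · have : z = i - 1 + w := by omega
            subst this
            rw [← a3 w (by omega), ← b3 w (by omega)]
            exact ihw (by omega) _ (by omega)
      intro z hz
      exact key n le_rfl z (by omega)

theorem lz_injective : Function.Injective (lz : List α → List (Phrase α)) := by
  intro X Y h
  exact List.ext_getElem? (eq_of_lzFrom_eq (X.length) 1 le_rfl (by omega) (by simp) h)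

theorem maxLZrev_frag_le_iff {S : List α} {p q k : ℕ} (hp : 1 ≤ p) (hpq : p ≤ q)
    (hq : q ≤ S.length + 1) :
    maxLZrev (frag S p q) ≤ k ↔
      ∀ l r, p ≤ l → l ≤ r → r ≤ q → (lz (frag S l r).reverse).length ≤ k := by
  rw [maxLZrev, Finset.sup_le_iff, frag_length hp hq]
  constructor
  · intro h l r h1 h2 h3
    have h4 := h (l + 1 - p) (Finset.mem_Icc.2 ⟨by omega, by omega⟩)
    rw [Finset.sup_le_iff] at h4
    have h5 := h4 (r + 1 - p) (Finset.mem_Icc.2 ⟨by omega, by omega⟩)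
    rw [frag_frag hp (by omega) (by omega)] at h5
    have e1 : p + (l + 1 - p) - 1 = l := by omega
    have e2 : p + (r + 1 - p) - 1 = r := by omega
    rwa [e1, e2] at h5
  · intro h l hl
    rw [Finset.sup_le_iff]
    intro r hr
    rw [Finset.mem_Icc] at hl hr
    rw [frag_frag hp (by omega) (by omega)]
    exact h _ _ (by omega) (by omega) (by omega)

/-! ### Ends of contexts -/

/-- All reversed fragments of `S[p .. q)` have at most `k` phrases. -/
def IsSimple (k : ℕ) (S : List α) (p q : ℕ) : Prop :=
  ∀ l r, p ≤ l → l ≤ r → r ≤ q → (lz (frag S l r).reverse).length ≤ k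

theorem IsSimple.mono {k : ℕ} {S : List α} {p q p' q' : ℕ} (h : IsSimple k S p q) (hp : p ≤ p')
    (hq : q' ≤ q) : IsSimple k S p' q' :=
  fun l r h1 h2 h3 => h l r (by omega) h2 (by omega)

/-- The position that follows the context of `S` at `p`. -/
def ctxEnd (k : ℕ) (S : List α) (p : ℕ) : ℕ := p + ctxLen k S p

theorem isSimple_self {k : ℕ} {S : List α} {p : ℕ} (hp : 1 ≤ p) (hp' : p ≤ S.length + 1) :
    IsSimple k S p p := by
  intro l r h1 h2 h3
  refine length_lz_le.trans ?_
  rw [List.length_reverse, frag_length (by omega) (by omega)]; omega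

theorem ctxLen_spec {k : ℕ} {S : List α} {p : ℕ} (hp : 1 ≤ p) (hp' : p ≤ S.length + 1) :
    ctxEnd k S p ≤ S.length + 1 ∧ IsSimple k S p (ctxEnd k S p) := by
  have := Nat.findGreatest_spec (m := 0) (n := S.length)
    (P := fun ℓ : ℕ => p + ℓ ≤ S.length + 1 ∧ maxLZrev (frag S p (p + ℓ)) ≤ k) (by omega)
    ⟨by omega, (maxLZrev_frag_le_iff hp (by omega) (by omega)).2 (isSimple_self hp hp')⟩
  exact ⟨this.1, (maxLZrev_frag_le_iff hp (by omega) this.1).1 this.2⟩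

theorem le_ctxEnd_self {k : ℕ} {S : List α} {p : ℕ} : p ≤ ctxEnd k S p := Nat.le_add_right _ _

theorem le_ctxEnd {k : ℕ} {S : List α} {p q : ℕ} (hp : 1 ≤ p) (hpq : p ≤ q)
    (hq : q ≤ S.length + 1) (h : IsSimple k S p q) : q ≤ ctxEnd k S p := by
  have : q - p ≤ ctxLen k S p := by
    refine Nat.le_findGreatest (by omega) ⟨by omega, ?_⟩
    have e : p + (q - p) = q := by omega
    rw [e]
    exact (maxLZrev_frag_le_iff hp hpq hq).2 h
  rw [ctxEnd]; omega

theorem lt_ctxEnd {k : ℕ} {S : List α} {p : ℕ} (hk : 1 ≤ k) (hp : 1 ≤ p) (hp' : p ≤ S.length) :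
    p < ctxEnd k S p := by
  refine le_ctxEnd hp (Nat.le_succ p) (by omega) ?_
  intro l r h1 h2 h3
  refine length_lz_le.trans ?_
  rw [List.length_reverse, frag_length (by omega) (by omega)]; omega

/-- Simplicity passes to fragments, so dropping a prefix of a context leaves a simple fragment with
the same end. -/
theorem ctxEnd_mono {k : ℕ} {S : List α} {p q : ℕ} (hp : 1 ≤ p) (hpq : p ≤ q)
    (hq : q ≤ S.length + 1) : ctxEnd k S p ≤ ctxEnd k S q := by
  by_cases h : ctxEnd k S p ≤ q
  · exact h.trans le_ctxEnd_self
  · have := ctxLen_spec (k := k) hp (hpq.trans hq)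
    exact le_ctxEnd (by omega) (by omega) this.1 (this.2.mono hpq le_rfl)

theorem not_isSimple_of_ctxEnd {k : ℕ} {S : List α} {p : ℕ} (hp : 1 ≤ p)
    (h : ctxEnd k S p ≤ S.length) : ¬ IsSimple k S p (ctxEnd k S p + 1) := by
  intro h1
  have := le_ctxEnd hp (by have := le_ctxEnd_self (k := k) (S := S) (p := p); omega) (by omega) h1
  omega

/-- Splitting greedily is optimal: by `ctxEnd_mono`, moving the split point as far right as possible
never shortens the second part. -/
theorem add_dctxLen {k : ℕ} {S : List α} {p : ℕ} (hp : 1 ≤ p) (hp' : p ≤ S.length + 1) :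
    p + dctxLen k S p = ctxEnd k S (ctxEnd k S p) := by
  have h1 := ctxLen_spec (k := k) hp hp'
  have h0 : p ≤ ctxEnd k S p := le_ctxEnd_self
  have h2 := ctxLen_spec (k := k) (hp.trans h0) h1.1
  have h3 : ctxEnd k S p ≤ ctxEnd k S (ctxEnd k S p) := le_ctxEnd_self
  apply le_antisymm
  · have := Nat.findGreatest_spec (m := 0) (n := S.length)
      (P := fun ℓ : ℕ => p + ℓ ≤ S.length + 1 ∧ ∃ r ∈ Finset.Icc p (p + ℓ),
        maxLZrev (frag S p r) ≤ k ∧ maxLZrev (frag S r (p + ℓ)) ≤ k) (by omega)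
      ⟨by omega, p, by simp, (maxLZrev_frag_le_iff hp (by omega) (by omega)).2
        (isSimple_self hp hp'),
        (maxLZrev_frag_le_iff hp (by omega) (by omega)).2 (isSimple_self hp hp')⟩
    obtain ⟨a, r, b, c, d⟩ := this
    change p + dctxLen k S p ≤ _ at a
    change r ∈ Finset.Icc p (p + dctxLen k S p) at b
    change maxLZrev (frag S r (p + dctxLen k S p)) ≤ k at d
    rw [Finset.mem_Icc] at b
    rw [maxLZrev_frag_le_iff hp b.1 (by omega)] at c
    rw [maxLZrev_frag_le_iff (by omega) b.2 a] at d
    have e1 := le_ctxEnd hp b.1 (by omega) c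
    have e2 := le_ctxEnd (by omega) b.2 a d
    exact e2.trans (ctxEnd_mono (by omega) e1 h1.1)
  · have : ctxEnd k S (ctxEnd k S p) - p ≤ dctxLen k S p := by
      have e : p + (ctxEnd k S (ctxEnd k S p) - p) = ctxEnd k S (ctxEnd k S p) := by omega
      refine Nat.le_findGreatest (by omega) ⟨by omega, ctxEnd k S p, ?_, ?_⟩
      · rw [Finset.mem_Icc]; omega
      · rw [e]
        exact ⟨(maxLZrev_frag_le_iff hp h0 h1.1).2 h1.2,
          (maxLZrev_frag_le_iff (by omega) h3 h2.1).2 h2.2⟩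
    omega

end Strings

/-! ### Largest powers of two -/

/-- Two numbers `2^j (2a + 1) < 2^j (2b + 1)` are separated by `2^j (2a + 2)`. This makes the
maximizer in `mu` unique and drives all logarithmic counts. -/
theorem exists_padicValNat_lt {w w' : ℕ} (hw : 0 < w) (h : w < w')
    (hv : padicValNat 2 w = padicValNat 2 w') :
    ∃ z, w < z ∧ z < w' ∧ padicValNat 2 w < padicValNat 2 z := by
  have key : ∀ u : ℕ, 0 < u → ∃ a, u = 2 ^ padicValNat 2 u * (2 * a + 1) := by
    intro u hu
    obtain ⟨b, hb⟩ := pow_padicValNat_dvd (p := 2) (n := u)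
    rcases Nat.even_or_odd' b with ⟨a, ha | ha⟩
    · exfalso
      apply pow_succ_padicValNat_not_dvd (p := 2) hu.ne'
      exact ⟨a, by rw [pow_succ, mul_assoc, ← ha]; exact hb⟩
    · exact ⟨a, by rw [← ha]; exact hb⟩
  obtain ⟨a, ha⟩ := key w hw
  obtain ⟨b, hb⟩ := key w' (by omega)
  rw [← hv] at hb
  set j := padicValNat 2 w
  have hj : 0 < 2 ^ j := by positivity
  have hab : 2 * a + 1 < 2 * b + 1 := by
    by_contra hcon
    have := Nat.mul_le_mul_left (2 ^ j) (not_lt.1 hcon)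
    omega
  refine ⟨2 ^ j * (2 * a + 2), ?_, ?_, ?_⟩
  · rw [ha]; exact Nat.mul_lt_mul_of_pos_left (by omega) hj
  · rw [hb]; exact Nat.mul_lt_mul_of_pos_left (by omega) hj
  · rw [← Nat.succ_le_iff]
    refine (padicValNat_dvd_iff_le (p := 2) (by positivity)).1 ?_
    exact ⟨a + 1, by rw [pow_succ]; ring⟩

theorem mu_spec {t v : ℕ} (h : t < v) :
    t ≤ mu t v ∧ mu t v < v ∧ ∀ w, t ≤ w → w < v → padicValNat 2 w ≤ padicValNat 2 (mu t v) := by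
  have hne : ((Finset.Ico t v).filter
    (fun w => ∀ w' ∈ Finset.Ico t v, padicValNat 2 w' ≤ padicValNat 2 w)).Nonempty := by
    obtain ⟨w, hw, hw'⟩ := Finset.exists_max_image (Finset.Ico t v) (padicValNat 2)
      ⟨t, Finset.mem_Ico.2 ⟨le_rfl, h⟩⟩
    exact ⟨w, Finset.mem_filter.2 ⟨hw, hw'⟩⟩
  have hs : mu t v = Finset.min' _ hne := by
    rw [mu, ← Finset.coe_min' hne]; rfl
  have := Finset.min'_mem _ hne
  rw [← hs, Finset.mem_filter, Finset.mem_Ico] at this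
  exact ⟨this.1.1, this.1.2, fun w h1 h2 => this.2 w (Finset.mem_Ico.2 ⟨h1, h2⟩)⟩

/-- If the order were reversed, each maximizer would lie in both intervals, so their valuations
would agree and a number of larger valuation would lie between them. -/
theorem mu_mono {t v t' v' : ℕ} (ht : 1 ≤ t) (h : t < v) (h' : t' < v') (htt : t ≤ t')
    (hvv : v ≤ v') : mu t v ≤ mu t' v' := by
  obtain ⟨a1, a2, a3⟩ := mu_spec h
  obtain ⟨b1, b2, b3⟩ := mu_spec h'
  by_contra hcon
  have h1 := a3 (mu t' v') (by omega) (by omega)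
  have h2 := b3 (mu t v) (by omega) (by omega)
  obtain ⟨z, z1, z2, z3⟩ := exists_padicValNat_lt (by omega) (not_le.1 hcon) (by omega)
  have := a3 z (by omega) (by omega)
  omega

/-! ### Walks -/

section Walks

variable {α : Type*} {m : ℕ} {S : List α} {s : ℕ → ℕ}

theorem IsCompleteWalk.mono (hs : IsCompleteWalk m S s) {a b : ℕ} (ha : 1 ≤ a) (hab : a ≤ b)
    (hb : b ≤ m + 1) : s a ≤ s b := by
  induction b, hab using Nat.le_induction with
  | base => exact le_rfl
  | succ b hab ih =>
    have h1 := ih (by omega)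
    rcases hs.2.2 b (Finset.mem_Icc.2 ⟨by omega, by omega⟩) with h | h <;> omega

theorem IsCompleteWalk.one_le (hs : IsCompleteWalk m S s) {a : ℕ} (ha : 1 ≤ a)
    (hb : a ≤ m + 1) : 1 ≤ s a := by
  have := hs.mono le_rfl ha hb
  rwa [hs.1] at this

theorem IsCompleteWalk.le_length (hs : IsCompleteWalk m S s) {a : ℕ} (ha : 1 ≤ a)
    (hb : a ≤ m + 1) : s a ≤ S.length + 1 := by
  have := hs.mono ha hb le_rfl
  rwa [hs.2.1] at this

/-- A discrete intermediate value theorem. -/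
theorem exists_eq_of_step {f : ℕ → ℕ} {a b c : ℕ} (hab : a ≤ b)
    (hf : ∀ t, a ≤ t → t < b → f (t + 1) ≤ f t + 1) (ha : f a ≤ c) (hb : c ≤ f b) :
    ∃ t, a ≤ t ∧ t ≤ b ∧ f t = c := by
  induction b, hab using Nat.le_induction with
  | base => exact ⟨a, le_rfl, le_rfl, by omega⟩
  | succ b hab ih =>
    by_cases h : c ≤ f b
    · obtain ⟨t, h1, h2, h3⟩ := ih (fun t h1 h2 => hf t h1 (by omega)) h
      exact ⟨t, h1, by omega, h3⟩
    · have := hf b hab (by omega)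
      exact ⟨b + 1, by omega, le_rfl, by omega⟩

theorem firstHit_le {q v : ℕ} (hv : 1 ≤ v) (hv' : v ≤ m + 1) (h : s v = q) :
    1 ≤ firstHit m s q ∧ s (firstHit m s q) = q ∧ firstHit m s q ≤ v := by
  have hmem : v ∈ (Finset.Icc 1 (m + 1)).filter (fun v => s v = q) :=
    Finset.mem_filter.2 ⟨Finset.mem_Icc.2 ⟨hv, hv'⟩, h⟩
  have hs : firstHit m s q = Finset.min' _ ⟨v, hmem⟩ := by
    rw [firstHit, ← Finset.coe_min' ⟨v, hmem⟩]; rfl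
  have := Finset.min'_mem _ ⟨v, hmem⟩
  rw [← hs, Finset.mem_filter, Finset.mem_Icc] at this
  exact ⟨this.1.1, this.2, hs ▸ Finset.min'_le _ _ hmem⟩

theorem IsCompleteWalk.firstHit_spec (hs : IsCompleteWalk m S s) {q : ℕ} (hq : 1 ≤ q)
    (hq' : q ≤ S.length + 1) :
    1 ≤ firstHit m s q ∧ firstHit m s q ≤ m + 1 ∧ s (firstHit m s q) = q ∧
      ∀ v, 1 ≤ v → v ≤ m + 1 → q ≤ s v → firstHit m s q ≤ v := by
  have key : ∀ v, 1 ≤ v → v ≤ m + 1 → q ≤ s v → 1 ≤ firstHit m s q ∧ s (firstHit m s q) = q ∧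
      firstHit m s q ≤ v := by
    intro v h1 h2 h3
    obtain ⟨t, t1, t2, t3⟩ := exists_eq_of_step (f := s) (c := q) h1 (fun (t : ℕ) (h1 : 1 ≤ t) (h2 : t < v) => by
      rcases hs.2.2 t (Finset.mem_Icc.2 ⟨by omega, by omega⟩) with h | h <;> omega)
      (by rw [hs.1]; exact hq) h3
    have := firstHit_le (m := m) t1 (by omega) t3
    exact ⟨this.1, this.2.1, by omega⟩
  obtain ⟨h1, h2, h3⟩ := key (m + 1) (by omega) le_rfl (by rw [hs.2.1]; exact hq')
  exact ⟨h1, h3, h2, fun v h1 h2 h3 => (key v h1 h2 h3).2.2⟩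

variable [DecidableEq α] {k : ℕ}

/-- The index at which a walk leaves the context of its position at index `t`. -/
def nxt (k : ℕ) (S : List α) (m : ℕ) (s : ℕ → ℕ) (t : ℕ) : ℕ :=
  if s t ≤ S.length then firstHit m s (ctxEnd k S (s t)) else m + 1

theorem nxt_le (hs : IsCompleteWalk m S s) {t : ℕ} (ht : 1 ≤ t) (ht' : t ≤ m + 1) :
    nxt k S m s t ≤ m + 1 := by
  rw [nxt]
  split_ifs with h
  · have h1 := hs.one_le ht ht'
    exact (hs.firstHit_spec (h1.trans le_ctxEnd_self) (ctxLen_spec h1 (by omega)).1).2.1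
  · exact le_rfl

theorem apply_nxt (hs : IsCompleteWalk m S s) {t : ℕ} (ht : 1 ≤ t) (ht' : t ≤ m + 1)
    (h : s t ≤ S.length) : s (nxt k S m s t) = ctxEnd k S (s t) := by
  have h1 := hs.one_le ht ht'
  rw [nxt, if_pos h]
  exact (hs.firstHit_spec (h1.trans le_ctxEnd_self) (ctxLen_spec h1 (by omega)).1).2.2.1

theorem lt_ctxEnd_of_lt_nxt (hs : IsCompleteWalk m S s) {t v : ℕ} (ht : 1 ≤ t) (ht' : t ≤ m + 1)
    (h : s t ≤ S.length) (hv : 1 ≤ v) (hvt : v < nxt k S m s t) : s v < ctxEnd k S (s t) := by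
  have h1 := hs.one_le ht ht'
  have h2 := nxt_le (k := k) hs ht ht'
  rw [nxt, if_pos h] at hvt h2
  by_contra hcon
  have h3 := (ctxLen_spec (k := k) (S := S) h1 (by omega)).1
  have := (hs.firstHit_spec (h1.trans le_ctxEnd_self) h3).2.2.2 v hv (by omega) (not_lt.1 hcon)
  omega

theorem lt_nxt (hs : IsCompleteWalk m S s) (hk : 1 ≤ k) {t : ℕ} (ht : 1 ≤ t) (ht' : t ≤ m + 1)
    (h : s t ≤ S.length) : t < nxt k S m s t := by
  have h1 := hs.one_le ht ht'
  have h2 := nxt_le (k := k) hs ht ht'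
  have h3 := apply_nxt (k := k) hs ht ht' h
  have h4 := lt_ctxEnd hk h1 h
  by_contra hcon
  have h5 : 1 ≤ nxt k S m s t := by
    rw [nxt, if_pos h]
    exact (hs.firstHit_spec (h1.trans le_ctxEnd_self) (ctxLen_spec h1 (by omega)).1).1
  have := hs.mono h5 (not_lt.1 hcon) ht'
  omega

theorem le_nxt (hs : IsCompleteWalk m S s) (hk : 1 ≤ k) {t : ℕ} (ht : 1 ≤ t) (ht' : t ≤ m + 1) :
    t ≤ nxt k S m s t := by
  by_cases h : s t ≤ S.length
  · exact (lt_nxt hs hk ht ht' h).le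
  · rwa [nxt, if_neg h]

theorem nxt_mono (hs : IsCompleteWalk m S s) {t t' : ℕ} (ht : 1 ≤ t) (h : t ≤ t')
    (ht' : t' ≤ m + 1) : nxt k S m s t ≤ nxt k S m s t' := by
  by_cases h1 : s t' ≤ S.length
  · have h2 := hs.mono ht h ht'
    have h3 := hs.one_le ht (h.trans ht')
    have h6 := (ctxLen_spec (k := k) (S := S) (p := s t') (by omega) (by omega)).1
    by_contra hcon
    have h5 : 1 ≤ nxt k S m s t' := by
      rw [nxt, if_pos h1]
      exact (hs.firstHit_spec ((h3.trans h2).trans le_ctxEnd_self) h6).1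
    have h4 := lt_ctxEnd_of_lt_nxt hs ht (h.trans ht') (h2.trans h1) h5 (not_le.1 hcon)
    rw [apply_nxt hs (by omega) ht' h1] at h4
    have := ctxEnd_mono (k := k) (S := S) h3 h2 (by omega)
    omega
  · conv_rhs => rw [nxt, if_neg h1]
    exact nxt_le hs ht (h.trans ht')

theorem nxt_iterate_mem (hs : IsCompleteWalk m S s) (hk : 1 ≤ k) (i : ℕ) {t : ℕ} (ht : 1 ≤ t)
    (ht' : t ≤ m + 1) : t ≤ (nxt k S m s)^[i] t ∧ (nxt k S m s)^[i] t ≤ m + 1 := by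
  induction i with
  | zero => exact ⟨le_rfl, ht'⟩
  | succ i ih =>
    rw [Function.iterate_succ_apply']
    exact ⟨ih.1.trans (le_nxt hs hk (by omega) ih.2), nxt_le hs (by omega) ih.2⟩

theorem nxt_iterate_mono (hs : IsCompleteWalk m S s) (hk : 1 ≤ k) (i : ℕ) {t t' : ℕ} (ht : 1 ≤ t)
    (h : t ≤ t') (ht' : t' ≤ m + 1) : (nxt k S m s)^[i] t ≤ (nxt k S m s)^[i] t' := by
  induction i with
  | zero => exact h
  | succ i ih =>
    rw [Function.iterate_succ_apply', Function.iterate_succ_apply']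
    have h1 := nxt_iterate_mem (k := k) hs hk i ht (h.trans ht')
    have h2 := nxt_iterate_mem (k := k) hs hk i (ht.trans h) ht'
    exact nxt_mono hs (by omega) ih h2.2

theorem muAt_eq {t : ℕ} (ht : 1 ≤ t) (h : s t ≤ S.length) :
    muAt k S m s t = mu t (nxt k S m s t) := by
  rw [muAt, if_neg (by omega), nxt, if_pos h]; rfl

theorem muAt_spec (hs : IsCompleteWalk m S s) (hk : 1 ≤ k) {t : ℕ} (ht : 1 ≤ t) (ht' : t ≤ m + 1)
    (h : s t ≤ S.length) : t ≤ muAt k S m s t ∧ muAt k S m s t < nxt k S m s t ∧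
      ∀ w, t ≤ w → w < nxt k S m s t → padicValNat 2 w ≤ padicValNat 2 (muAt k S m s t) := by
  rw [muAt_eq ht h]
  exact mu_spec (lt_nxt hs hk ht ht' h)

theorem muAt_mono (hs : IsCompleteWalk m S s) (hk : 1 ≤ k) {t t' : ℕ} (htt : t ≤ t')
    (ht' : t' ≤ m + 1) (h : s t' ≤ S.length) : muAt k S m s t ≤ muAt k S m s t' := by
  rcases Nat.eq_zero_or_pos t with rfl | ht
  · simp [muAt]
  have h1 := hs.mono ht htt ht'
  rw [muAt_eq ht (h1.trans h), muAt_eq (ht.trans_le htt) h]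
  exact mu_mono ht (lt_nxt hs hk ht (htt.trans ht') (h1.trans h))
    (lt_nxt hs hk (by omega) ht' h) htt (nxt_mono hs ht htt ht')

/-- Take the first `u` with the same value of `muAt` as `t`. It is stored because the value has just
increased, and its context reaches past `t` because that common value is at least `t`. -/
theorem exists_stored (hs : IsCompleteWalk m S s) (hk : 1 ≤ k) {t : ℕ} (ht : 1 ≤ t)
    (ht' : t ≤ m + 1) (h : s t ≤ S.length) :
    ∃ u, 1 ≤ u ∧ u ≤ t ∧ Stored k S m s u ∧ t < nxt k S m s u := by
  have hex : ∃ u, muAt k S m s u = muAt k S m s t := ⟨t, rfl⟩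
  set u := Nat.find hex with hu
  have h1 : muAt k S m s u = muAt k S m s t := Nat.find_spec hex
  have h2 : u ≤ t := Nat.find_min' hex rfl
  have h3 := muAt_spec hs hk ht ht' h
  have h4 : 1 ≤ u := by
    by_contra hcon
    have : u = 0 := by omega
    rw [this] at h1
    simp only [muAt, if_true] at h1
    simp only [muAt] at h3
    omega
  have h5 := (hs.mono h4 h2 ht').trans h
  refine ⟨u, h4, h2, ⟨h4, h5, ?_⟩, ?_⟩
  · refine lt_of_le_of_ne (muAt_mono hs hk (Nat.sub_le _ _) (h2.trans ht') h5) ?_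
    intro h6
    exact Nat.find_min hex (m := u - 1) (by omega) (h6.trans h1)
  · have := (muAt_spec hs hk h4 (h2.trans ht') h5).2.1
    omega

theorem muAt_lt_of_stored (hs : IsCompleteWalk m S s) (hk : 1 ≤ k) {t t' : ℕ} (htt : t < t')
    (ht' : t' ≤ m + 1) (h : Stored k S m s t') : muAt k S m s t < muAt k S m s t' := by
  -- For `t' = 1` the predecessor is index `0`, where the walk is unconstrained; index `1` is then
  -- compared with itself.
  have h1 := hs.mono (a := t' - 1 + (if t' = 1 then 1 else 0)) (b := t')
    (by have := h.1; split_ifs <;> omega)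
    (by have := h.1; split_ifs <;> omega) ht'
  rcases Nat.eq_zero_or_pos t with rfl | ht
  · simp only [muAt, if_true]
    have := muAt_spec hs hk h.1 ht' h.2.1
    have h2 := h.1
    simp only [muAt] at this
    omega
  refine lt_of_le_of_lt (muAt_mono hs hk (by omega) (by omega) ?_) h.2.2
  rw [if_neg (by omega)] at h1
  exact h1.trans h.2.1

/-- Only logarithmically many of the stored contexts contain a given index. -/
theorem card_stored_context_le (hs : IsCompleteWalk m S s) (hk : 1 ≤ k) (σ : ℕ) :
    ((Finset.Icc 1 m).filter
      (fun t => Stored k S m s t ∧ t ≤ σ ∧ σ < nxt k S m s t)).card ≤ Nat.log 2 m + 1 := by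
  rw [← Finset.card_range (Nat.log 2 m + 1)]
  refine Finset.card_le_card_of_injOn (fun t => padicValNat 2 (muAt k S m s t)) ?_ ?_
  · intro t ht
    simp only [Finset.coe_filter, Finset.mem_Icc, Set.mem_ofPred_eq] at ht
    obtain ⟨h1, h2, h3, h4⟩ := ht
    have h5 := muAt_spec hs hk h1.1 (by omega) h2.2.1
    have h6 := nxt_le (k := k) hs h1.1 (by omega)
    have h7 : padicValNat 2 (muAt k S m s t) ≤ Nat.log 2 (muAt k S m s t) :=
      padicValNat_le_nat_log _
    have h8 : Nat.log 2 (muAt k S m s t) ≤ Nat.log 2 m := Nat.log_mono_right (by omega)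
    simp only [Finset.coe_range, Set.mem_Iio]
    omega
  -- Both intervals contain `σ`, so everything between their maximizers lies in one of them. Stored
  -- maximizers are distinct, so equal valuations would put a larger one in between.
  · have key : ∀ t t', 1 ≤ t → t < t' → t' ≤ m → Stored k S m s t → Stored k S m s t' → t' ≤ σ →
        σ < nxt k S m s t →
        padicValNat 2 (muAt k S m s t) ≠ padicValNat 2 (muAt k S m s t') := by
      intro t t' h1 h2 h3 h4 h5 h6 h7 h8
      have a := muAt_spec hs hk h1 (by omega) h4.2.1
      have b := muAt_spec hs hk (by omega) (by omega) h5.2.1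
      obtain ⟨z, z1, z2, z3⟩ := exists_padicValNat_lt (by omega)
        (muAt_lt_of_stored hs hk h2 (by omega) h5) h8
      by_cases hz : z ≤ σ
      · have := a.2.2 z (by omega) (by omega); omega
      · have := b.2.2 z (by omega) (by omega); omega
    intro t ht t' ht' htt
    simp only [Finset.coe_filter, Finset.mem_Icc, Set.mem_ofPred_eq] at ht ht'
    simp only at htt
    rcases lt_trichotomy t t' with h | h | h
    · exact absurd htt (key t t' ht.1.1 h ht'.1.2 ht.2.1 ht'.2.1 ht'.2.2.1 ht.2.2.2)
    · exact h
    · exact absurd htt.symm (key t' t ht'.1.1 h ht.1.2 ht'.2.1 ht.2.1 ht.2.2.1 ht'.2.2.2)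

theorem card_stored_layer_le (hs : IsCompleteWalk m S s) (hk : 1 ≤ k) (i τ : ℕ) :
    ((Finset.Icc 1 m).filter
      (fun t => Stored k S m s t ∧ (nxt k S m s)^[i] t ≤ τ ∧ τ < (nxt k S m s)^[i + 1] t)).card ≤
        Nat.log 2 m + 1 := by
  set T := (Finset.Icc 1 m).filter
      (fun t => Stored k S m s t ∧ (nxt k S m s)^[i] t ≤ τ ∧ τ < (nxt k S m s)^[i + 1] t) with hT
  rcases T.eq_empty_or_nonempty with h | hne
  · rw [h]; simp
  have hmem : ∀ t ∈ T, (1 ≤ t ∧ t ≤ m) ∧ Stored k S m s t ∧ (nxt k S m s)^[i] t ≤ τ ∧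
      τ < (nxt k S m s)^[i + 1] t := fun t ht => by
    rw [hT, Finset.mem_filter, Finset.mem_Icc] at ht; exact ht
  obtain ⟨t₁, ht₁, hmin⟩ : ∃ t₁ ∈ T, ∀ t ∈ T, t₁ ≤ t :=
    ⟨T.min' hne, T.min'_mem hne, fun t ht => T.min'_le t ht⟩
  obtain ⟨a1, a2, a3, a4⟩ := hmem t₁ ht₁
  have a5 := lt_nxt hs hk a1.1 (by omega) a2.2.1
  have a6 := nxt_le (k := k) hs a1.1 (by omega)
  -- All these contexts contain the last index of the leftmost one: starting at or after its end
  -- would push the `i`-th iterate beyond `τ`.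
  refine (Finset.card_le_card ?_).trans (card_stored_context_le hs hk (nxt k S m s t₁ - 1))
  intro t ht
  obtain ⟨b1, b2, b3, b4⟩ := hmem t ht
  have b5 : t₁ ≤ t := hmin t ht
  have b6 := nxt_mono (k := k) hs a1.1 b5 (by omega)
  refine Finset.mem_filter.2 ⟨Finset.mem_Icc.2 b1, b2, ?_, by omega⟩
  by_contra hcon
  have := nxt_iterate_mono hs hk i (t := nxt k S m s t₁) (t' := t) (by omega) (by omega) (by omega)
  rw [← Function.iterate_succ_apply, Nat.succ_eq_add_one] at this
  omega

/-- Index `1` is stored whenever `S` is non-empty, so the default value `0` does not occur for `t ≥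
2`. -/
theorem lastStored_spec (hs : IsCompleteWalk m S s) (hk : 1 ≤ k) {t : ℕ} (ht : 2 ≤ t)
    (ht' : t ≤ m + 1) (h : s t ≤ S.length) :
    1 ≤ lastStored k S m s t ∧ lastStored k S m s t < t ∧ Stored k S m s (lastStored k S m s t) ∧
      ∀ u, lastStored k S m s t < u → u < t → ¬ Stored k S m s u := by
  obtain ⟨u, h1, h2, h3, -⟩ := exists_stored hs hk (t := 1) le_rfl (by omega)
    ((hs.mono le_rfl (by omega) ht').trans h)
  have h4 := Nat.findGreatest_spec (P := fun u => Stored k S m s u) (m := u) (n := t - 1)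
    (by omega) h3
  have h5 := Nat.findGreatest_le (P := fun u => Stored k S m s u) (t - 1)
  refine ⟨h4.1, ?_, h4, ?_⟩
  · change Nat.findGreatest _ _ < t
    omega
  · intro v h6 h7
    exact Nat.findGreatest_is_greatest h6 (by omega)

/-- The number of stored indices whose extended neighbourhood contains a given index is
logarithmic. -/
theorem card_stored_neighbourhood_le (hs : IsCompleteWalk m S s) (hk : 1 ≤ k) (τ : ℕ) :
    ((Finset.Icc 1 m).filter
      (fun t => Stored k S m s t ∧ lastStored k S m s t ≤ τ + 1 ∧
        τ < (nxt k S m s)^[3] t)).card ≤ 3 * (Nat.log 2 m + 1) + 2 := by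
  set L : ℕ → Finset ℕ := fun i => (Finset.Icc 1 m).filter
      (fun t => Stored k S m s t ∧ (nxt k S m s)^[i] t ≤ τ ∧ τ < (nxt k S m s)^[i + 1] t) with hL
  -- Of two stored indices beyond `τ + 1`, the larger one has its predecessor beyond `τ + 1` too, so
  -- `R` has at most one element. The other indices are `τ + 1` or lie in one of three layers.
  set R : Finset ℕ := (Finset.Icc 1 m).filter
    (fun t => Stored k S m s t ∧ τ + 1 < t ∧ lastStored k S m s t ≤ τ + 1) with hR
  have hR1 : R.card ≤ 1 := by
    rw [Finset.card_le_one]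
    have key : ∀ a ∈ R, ∀ b ∈ R, ¬ a < b := by
      intro a ha b hb hab
      rw [hR, Finset.mem_filter, Finset.mem_Icc] at ha hb
      exact (lastStored_spec hs hk (t := b) (by omega) (by omega) hb.2.1.2.1).2.2.2 a (by omega) hab
        ha.2.1
    intro a ha b hb
    have h1 := key a ha b hb
    have h2 := key b hb a ha
    omega
  have hsub : ((Finset.Icc 1 m).filter
      (fun t => Stored k S m s t ∧ lastStored k S m s t ≤ τ + 1 ∧
        τ < (nxt k S m s)^[3] t)) ⊆ (L 0 ∪ L 1 ∪ L 2) ∪ ({τ + 1} ∪ R) := by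
    intro t ht
    rw [Finset.mem_filter] at ht
    obtain ⟨h1, h2, h3, h4⟩ := ht
    have hmem : ∀ i, (nxt k S m s)^[i] t ≤ τ → τ < (nxt k S m s)^[i + 1] t → t ∈ L i :=
      fun i a b => Finset.mem_filter.2 ⟨h1, h2, a, b⟩
    rw [Finset.mem_union, Finset.mem_union, Finset.mem_union, Finset.mem_union,
      Finset.mem_singleton]
    by_cases a0 : t ≤ τ
    swap
    · right
      by_cases a1 : t = τ + 1
      · exact Or.inl a1
      · exact Or.inr (Finset.mem_filter.2 ⟨h1, h2, by omega, h3⟩)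
    left
    by_cases a1 : τ < (nxt k S m s)^[1] t
    · exact Or.inl (Or.inl (hmem 0 a0 a1))
    by_cases a2 : τ < (nxt k S m s)^[2] t
    · exact Or.inl (Or.inr (hmem 1 (not_lt.1 a1) a2))
    · exact Or.inr (hmem 2 (not_lt.1 a2) h4)
  have c0 := card_stored_layer_le hs hk 0 τ
  have c1 := card_stored_layer_le hs hk 1 τ
  have c2 := card_stored_layer_le hs hk 2 τ
  have d1 := Finset.card_union_le (L 0 ∪ L 1 ∪ L 2) ({τ + 1} ∪ R)
  have d2 := Finset.card_union_le (L 0 ∪ L 1) (L 2)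
  have d3 := Finset.card_union_le (L 0) (L 1)
  have d4 := Finset.card_union_le {τ + 1} R
  rw [Finset.card_singleton] at d4
  have := Finset.card_le_card hsub
  simp only [hL] at *
  omega

end Walks

/-! ### Pairs of complete walks -/

section Paths

variable {α : Type*} {X Y : List α} {m n : ℕ} {x y u v : ℕ → ℕ}

/-- The pair of walks contains the match `(i, j)`. -/
def IsMatch (X Y : List α) (m : ℕ) (x y : ℕ → ℕ) (i j : ℕ) : Prop :=
  ∃ t, 1 ≤ t ∧ t ≤ m ∧ x t = i ∧ y t = j ∧ x (t + 1) = i + 1 ∧ y (t + 1) = j + 1 ∧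
    SameChar X Y (i, j)

theorem SameChar.swap {p : ℕ × ℕ} (h : SameChar X Y p) : SameChar Y X p.swap :=
  ⟨h.2.1, h.1, h.2.2.symm⟩

theorem sameChar_swap_iff {i j : ℕ} : SameChar Y X (j, i) ↔ SameChar X Y (i, j) :=
  ⟨fun h => h.swap, fun h => h.swap⟩

theorem isMatchStep_iff {i j i' j' : ℕ} :
    IsMatchStep X Y (i, j) (i', j') ↔ i' = i + 1 ∧ j' = j + 1 ∧ SameChar X Y (i, j) := by
  simp [IsMatchStep, and_assoc]

theorem IsMatch.swap {i j : ℕ} (h : IsMatch X Y m x y i j) : IsMatch Y X m y x j i := by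
  obtain ⟨t, h1, h2, h3, h4, h5, h6, h7⟩ := h
  exact ⟨t, h1, h2, h4, h3, h6, h5, h7.swap⟩

theorem IsMatch.right_unique (hx : IsCompleteWalk m X x) {i j j' : ℕ}
    (h : IsMatch X Y m x y i j) (h' : IsMatch X Y m x y i j') : j = j' := by
  obtain ⟨t, h1, h2, h3, h4, h5, -, -⟩ := h
  obtain ⟨t', h1', h2', h3', h4', h5', -, -⟩ := h'
  rcases lt_trichotomy t t' with h | h | h
  · have := hx.mono (a := t + 1) (b := t') (by omega) h (by omega); omega
  · subst h; omega
  · have := hx.mono (a := t' + 1) (b := t) (by omega) h (by omega); omega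

theorem IsMatch.left_unique (hy : IsCompleteWalk m Y y) {i i' j : ℕ}
    (h : IsMatch X Y m x y i j) (h' : IsMatch X Y m x y i' j) : i = i' :=
  h.swap.right_unique hy h'.swap

theorem IsCompleteWalk.exists_time_ge (hx : IsCompleteWalk m X x) {a i : ℕ} (ha : 1 ≤ a)
    (ha' : a ≤ m + 1) (hi : x a ≤ i) (hi' : i ≤ X.length + 1) :
    ∃ t, a ≤ t ∧ t ≤ m + 1 ∧ x t = i :=
  exists_eq_of_step (f := x) ha' (fun t h1 h2 => by
    rcases hx.2.2 t (Finset.mem_Icc.2 ⟨by omega, by omega⟩) with h | h <;> omega) hi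
    (by rw [hx.2.1]; exact hi')

theorem IsCompleteWalk.exists_step (hx : IsCompleteWalk m X x) {a i : ℕ} (ha : 1 ≤ a)
    (ha' : a ≤ m + 1) (hi : x a ≤ i) (hi' : i ≤ X.length) :
    ∃ t, a ≤ t ∧ t ≤ m ∧ x t = i ∧ x (t + 1) = i + 1 := by
  have hex : ∃ t, a ≤ t ∧ t ≤ m + 1 ∧ x t = i + 1 :=
    hx.exists_time_ge ha ha' (by omega) (by omega)
  obtain ⟨h1, h2, h3⟩ := Nat.find_spec hex
  set t := Nat.find hex
  have h4 : a < t := by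
    rcases Nat.lt_or_ge a t with h | h
    · exact h
    · have : t = a := by omega
      rw [this] at h3; omega
  have h5 : ¬ (a ≤ t - 1 ∧ t - 1 ≤ m + 1 ∧ x (t - 1) = i + 1) :=
    Nat.find_min hex (m := t - 1) (by omega)
  have h6 := hx.2.2 (t - 1) (Finset.mem_Icc.2 ⟨by omega, by omega⟩)
  have h7 : t - 1 + 1 = t := by omega
  rw [h7] at h6
  have h8 : x (t - 1) ≠ i + 1 := fun h => h5 ⟨by omega, by omega, h⟩
  exact ⟨t - 1, by omega, by omega, by omega, by rw [h7, h3]⟩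

/-! ### Disjoint walk pairs do not cross -/

/-- In a fixed row the second walk takes consecutive values, so it cannot skip `j` while having
values on both sides of it. -/
theorem above_or_below (hx : IsCompleteWalk m X x) (hy : IsCompleteWalk m Y y) {i j : ℕ}
    (hoff : ∀ t, 1 ≤ t → t ≤ m + 1 → ¬ (x t = i ∧ y t = j)) :
    (∀ t, 1 ≤ t → t ≤ m + 1 → x t = i → y t < j) ∨
      (∀ t, 1 ≤ t → t ≤ m + 1 → x t = i → j < y t) := by
  by_contra hcon
  push Not at hcon
  obtain ⟨⟨t, h1, h2, h3, h4⟩, t', h1', h2', h3', h4'⟩ := hcon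
  have h5 : t' ≤ t := by
    by_contra h
    have := hy.mono h1 (not_le.1 h).le h2'
    exact hoff t h1 h2 ⟨h3, by omega⟩
  obtain ⟨s, s1, s2, s3⟩ := exists_eq_of_step (f := y) (c := j) h5 (fun a ha hb => by
    rcases hy.2.2 a (Finset.mem_Icc.2 ⟨by omega, by omega⟩) with h | h <;> omega) h4' h4
  have h6 := hx.mono h1' s1 (by omega)
  have h7 := hx.mono (a := s) (b := t) (by omega) s2 h2
  exact hoff s (by omega) (by omega) ⟨by omega, s3⟩

variable [DecidableEq α]

/-- The indices at which the pair of walks moves without matching two characters. -/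
def breakTimes (X Y : List α) (m : ℕ) (x y : ℕ → ℕ) : Finset ℕ :=
  (Finset.Icc 1 m).filter (fun t => ¬ (x (t + 1) = x t ∧ y (t + 1) = y t) ∧
    ¬ (x (t + 1) = x t + 1 ∧ y (t + 1) = y t + 1 ∧ SameChar X Y (x t, y t)))

theorem mem_breakTimes {t : ℕ} : t ∈ breakTimes X Y m x y ↔ (1 ≤ t ∧ t ≤ m) ∧
    ¬ (x (t + 1) = x t ∧ y (t + 1) = y t) ∧
    ¬ (x (t + 1) = x t + 1 ∧ y (t + 1) = y t + 1 ∧ SameChar X Y (x t, y t)) := by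
  rw [breakTimes, Finset.mem_filter, Finset.mem_Icc]

theorem breakTimes_swap : breakTimes Y X m y x = breakTimes X Y m x y := by
  ext t
  rw [mem_breakTimes, mem_breakTimes, sameChar_swap_iff]
  tauto

theorem step_of_notMem_breakTimes {t : ℕ} (ht : 1 ≤ t) (ht' : t ≤ m)
    (h : t ∉ breakTimes X Y m x y) : (x (t + 1) = x t ∧ y (t + 1) = y t) ∨
      (x (t + 1) = x t + 1 ∧ y (t + 1) = y t + 1 ∧ SameChar X Y (x t, y t)) := by
  rw [mem_breakTimes] at h; tauto

/-- The difference of the two walks starts at `0`, changes only at breaks, and by at most one each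
time. -/
theorem dist_le_card_breakTimes (hx : IsCompleteWalk m X x) (hy : IsCompleteWalk m Y y) {t : ℕ}
    (ht : 1 ≤ t) (ht' : t ≤ m + 1) :
    x t ≤ y t + (breakTimes X Y m x y).card ∧ y t ≤ x t + (breakTimes X Y m x y).card := by
  have key : x t ≤ y t + ((breakTimes X Y m x y).filter (· < t)).card ∧
      y t ≤ x t + ((breakTimes X Y m x y).filter (· < t)).card := by
    induction t, ht using Nat.le_induction with
    | base => rw [hx.1, hy.1]; omega
    | succ t ht ih =>
      have h1 := ih (by omega)
      have h2 : ((breakTimes X Y m x y).filter (· < t)).card ≤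
          ((breakTimes X Y m x y).filter (· < t + 1)).card :=
        Finset.card_le_card (Finset.monotone_filter_right _ (fun a _ h => Nat.lt_succ_of_lt h))
      by_cases hb : t ∈ breakTimes X Y m x y
      · have h3 : ((breakTimes X Y m x y).filter (· < t)).card <
            ((breakTimes X Y m x y).filter (· < t + 1)).card := by
          apply Finset.card_lt_card
          rw [Finset.ssubset_iff_of_subset
            (Finset.monotone_filter_right _ (fun a _ h => Nat.lt_succ_of_lt h))]
          exact ⟨t, Finset.mem_filter.2 ⟨hb, by omega⟩, fun h => by
            have := (Finset.mem_filter.1 h).2; omega⟩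
        have h4 := hx.2.2 t (Finset.mem_Icc.2 ⟨ht, by omega⟩)
        have h5 := hy.2.2 t (Finset.mem_Icc.2 ⟨ht, by omega⟩)
        omega
      · rcases step_of_notMem_breakTimes ht (by omega) hb with h | h <;> omega
  have := Finset.card_filter_le (breakTimes X Y m x y) (· < t)
  omega

/-- The step that leaves row `i` is not a break, so it must be a match. -/
theorem exists_isMatch_of_row (hx : IsCompleteWalk m X x) {i : ℕ} (hi : 1 ≤ i)
    (hi' : i ≤ X.length) (h : ∀ t ∈ breakTimes X Y m x y, x t ≠ i) :
    ∃ j, IsMatch X Y m x y i j := by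
  obtain ⟨t, h1, h2, h3, h4⟩ := hx.exists_step (a := 1) le_rfl (by omega) (by rw [hx.1]; exact hi)
    hi'
  rcases step_of_notMem_breakTimes h1 h2 (fun hb => h t hb h3) with h5 | h5
  · omega
  · exact ⟨y t, t, h1, h2, h3, rfl, h4, h5.2.1, h3 ▸ h5.2.2⟩

/-- After the match, the pair can only wait at `(i + 1, j + 1)` until it leaves the row by a match.
-/
theorem IsMatch.succ_of_row (hx : IsCompleteWalk m X x) {i j : ℕ} (h : IsMatch X Y m x y i j)
    (hi : i + 1 ≤ X.length) (hb : ∀ t ∈ breakTimes X Y m x y, x t ≠ i + 1) :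
    IsMatch X Y m x y (i + 1) (j + 1) := by
  obtain ⟨t, h1, h2, -, -, h5, h6, -⟩ := h
  obtain ⟨t', a1, a2, a3, a4⟩ := hx.exists_step (a := t + 1) (by omega) (by omega) h5.le hi
  have key : ∀ w, t + 1 ≤ w → w ≤ t' → y w = j + 1 := by
    intro w hw
    induction w, hw using Nat.le_induction with
    | base => intro _; exact h6
    | succ w hw ih =>
      intro hw'
      have b1 := ih (by omega)
      have b2 := hx.mono (a := t + 1) (b := w) (by omega) hw (by omega)
      have b3 := hx.mono (a := w) (b := w + 1) (by omega) (by omega) (by omega)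
      have b4 := hx.mono (a := w + 1) (b := t') (by omega) hw' (by omega)
      rcases step_of_notMem_breakTimes (by omega) (by omega) (fun hbt => hb w hbt (by omega)) with
        h | h <;> omega
  have hy' := key t' a1 le_rfl
  rcases step_of_notMem_breakTimes (by omega) a2 (fun hbt => hb t' hbt a3) with h | h
  · omega
  · exact ⟨t', by omega, a2, a3, hy', a4, by omega, by rw [← a3, ← hy']; exact h.2.2⟩

theorem exists_isMatch_of_col (hy : IsCompleteWalk m Y y) {j : ℕ} (hj : 1 ≤ j)
    (hj' : j ≤ Y.length) (h : ∀ t ∈ breakTimes X Y m x y, y t ≠ j) :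
    ∃ i, IsMatch X Y m x y i j := by
  rw [← breakTimes_swap] at h
  obtain ⟨i, hi⟩ := exists_isMatch_of_row hy hj hj' h
  exact ⟨i, hi.swap⟩

theorem IsMatch.succ_of_col (hy : IsCompleteWalk m Y y) {i j : ℕ} (h : IsMatch X Y m x y i j)
    (hj : j + 1 ≤ Y.length) (hb : ∀ t ∈ breakTimes X Y m x y, y t ≠ j + 1) :
    IsMatch X Y m x y (i + 1) (j + 1) := by
  rw [← breakTimes_swap] at hb
  exact (h.swap.succ_of_row hy hj hb).swap

/-- The indices of breaks at positions of `X` strictly between `p` and `r`. -/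
def breakTimesIn (X Y : List α) (m : ℕ) (x y : ℕ → ℕ) (p r : ℕ) : Finset ℕ :=
  (breakTimes X Y m x y).filter (fun t => p < x t ∧ x t < r)

/-- If the walk pair `(x, y)` runs strictly above the walk pair `(u, v)`, then the reverse of
`X[p .. r)` has few phrases: following a match of `(x, y)` and then a match of `(u, v)` leads from
a character of `X` to a later copy. -/
theorem length_lz_le_of_above (hx : IsCompleteWalk m X x) (hy : IsCompleteWalk m Y y)
    (hu : IsCompleteWalk n X u) (hv : IsCompleteWalk n Y v) {p r w w' : ℕ} (hp : 1 ≤ p)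
    (hr : r ≤ X.length + 1)
    (habove : ∀ s t, 1 ≤ s → s ≤ m + 1 → 1 ≤ t → t ≤ n + 1 → p < x s → x s < r → u t = x s →
      v t < y s)
    (hw : ∀ t, 1 ≤ t → t ≤ m + 1 → y t ≤ x t + w)
    (hw' : ∀ t, 1 ≤ t → t ≤ n + 1 → u t ≤ v t + w') :
    (lz (frag X p r).reverse).length ≤
      w + w' + 2 * (breakTimesIn X Y m x y p r).card + 2 * (breakTimesIn X Y n u v p r).card
        + 2 := by
  classical
  -- `C z d` says that the detour through `Y` copies `X[z]` to `X[z + d]`, still inside the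
  -- fragment.
  set C : ℕ → ℕ → Prop := fun z d => ∃ j, IsMatch X Y m x y z j ∧ IsMatch X Y n u v (z + d) j ∧
    z + d < r with hC
  have hCuniq : ∀ z d d', C z d → C z d' → d = d' := by
    rintro z d d' ⟨j, a1, a2, -⟩ ⟨j', b1, b2, -⟩
    have := a1.right_unique hx b1
    subst this
    have := a2.left_unique hv b2
    omega
  -- Were `(u, v)` in column `j` at or before row `z`, it would reach row `z` at height at least
  -- `j`, contradicting strict separation.
  have hcross : ∀ z j t, p < z → z < r → IsMatch X Y m x y z j → 1 ≤ t → t ≤ n + 1 → v t = j →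
      z < u t := by
    rintro z j t h1 h2 ⟨s, s1, s2, s3, s4, -⟩ h4 h5 h6
    by_contra hcon
    obtain ⟨t', t1, t2, t3⟩ := hu.exists_time_ge h4 h5 (not_lt.1 hcon) (by omega)
    have := habove s t' s1 (by omega) (by omega) t2 (by omega) (by omega) (by omega)
    have := hv.mono h4 t1 t2
    omega
  -- The positions after which the offset is not continued; these are the cuts of the factorization.
  set N : Finset ℕ := (Finset.Ico (p + 1) (r - 1)).filter
    (fun z => ¬ ∃ d, 0 < d ∧ C z d ∧ C (z + 1) d) with hN
  set B := breakTimesIn X Y m x y p r with hB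
  set B' := breakTimesIn X Y n u v p r with hB'
  set F3 := (Finset.Ico (p + 1) (r - 1)).filter
    (fun z => ∃ t ∈ B', IsMatch X Y m x y z (v t)) with hF3
  set F4 := (Finset.Ico (p + 1) (r - 1)).filter
    (fun z => ∃ t ∈ B', IsMatch X Y m x y z (v t - 1)) with hF4
  have hcard3 : F3.card ≤ B'.card := by
    refine Finset.card_le_card_of_forall_subsingleton
      (fun z t => IsMatch X Y m x y z (v t)) ?_ ?_
    · intro z hz
      exact (Finset.mem_filter.1 hz).2
    · rintro t - z ⟨-, hz⟩ z' ⟨-, hz'⟩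
      exact hz.left_unique hy hz'
  have hcard4 : F4.card ≤ B'.card := by
    refine Finset.card_le_card_of_forall_subsingleton
      (fun z t => IsMatch X Y m x y z (v t - 1)) ?_ ?_
    · intro z hz
      exact (Finset.mem_filter.1 hz).2
    · rintro t - z ⟨-, hz⟩ z' ⟨-, hz'⟩
      exact hz.left_unique hy hz'
  -- Offsets are at most `w + w'`, so only the last `w + w'` positions can copy beyond `r`. Any
  -- other cut is due to a break of `(x, y)` in row `z` or `z + 1`, or of `(u, v)` in column `j` or
  -- `j + 1`, where `j` is matched with `z`.
  have hsub : N ⊆ (Finset.Ico (r - 1 - (w + w')) (r - 1) ∪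
      (B.image x ∪ B.image (fun t => x t - 1))) ∪ (F3 ∪ F4) := by
    intro z hz
    by_contra hcon
    simp only [Finset.mem_union, not_or] at hcon
    obtain ⟨⟨n1, n2, n3⟩, n4, n5⟩ := hcon
    rw [hN, Finset.mem_filter] at hz
    obtain ⟨hzI, hz⟩ := hz
    have hz' := hzI
    rw [Finset.mem_Ico] at hz' n1
    apply hz
    have b1 : ∀ t ∈ breakTimes X Y m x y, x t ≠ z := by
      intro t ht h
      exact n2 (Finset.mem_image.2 ⟨t, Finset.mem_filter.2 ⟨ht, by omega, by omega⟩, h⟩)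
    have b2 : ∀ t ∈ breakTimes X Y m x y, x t ≠ z + 1 := by
      intro t ht h
      exact n3 (Finset.mem_image.2 ⟨t, Finset.mem_filter.2 ⟨ht, by omega, by omega⟩, by omega⟩)
    obtain ⟨j, hj⟩ := exists_isMatch_of_row hx (by omega) (by omega) b1
    have hj1 := hj.succ_of_row hx (by omega) b2
    obtain ⟨s, s1, s2, s3, s4, s5, s6, s7⟩ := hj
    have hj : IsMatch X Y m x y z j := ⟨s, s1, s2, s3, s4, s5, s6, s7⟩
    have hjw := hw s s1 (by omega)
    have hY1 := s7.2.1
    have hY2 : j + 1 ≤ Y.length := by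
      obtain ⟨_, _, _, _, _, _, _, h⟩ := hj1
      exact h.2.1.2
    simp only at hY1
    have b3 : ∀ t ∈ breakTimes X Y n u v, v t ≠ j := by
      intro t ht h
      have ht' := (mem_breakTimes.1 ht).1
      have c1 := hcross z j t (by omega) (by omega) hj ht'.1 (by omega) h
      have c2 := hw' t ht'.1 (by omega)
      refine n4 (Finset.mem_filter.2 ⟨hzI, t, Finset.mem_filter.2 ⟨ht, ?_, ?_⟩, h ▸ hj⟩)
      · omega
      · omega
    have b4 : ∀ t ∈ breakTimes X Y n u v, v t ≠ j + 1 := by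
      intro t ht h
      have ht' := (mem_breakTimes.1 ht).1
      have c1 := hcross (z + 1) (j + 1) t (by omega) (by omega) hj1 ht'.1 (by omega) h
      have c2 := hw' t ht'.1 (by omega)
      refine n5 (Finset.mem_filter.2 ⟨hzI, t, Finset.mem_filter.2 ⟨ht, ?_, ?_⟩, ?_⟩)
      · omega
      · omega
      · rw [h]; exact hj
    obtain ⟨i, hi⟩ := exists_isMatch_of_col hv (by omega) (by omega) b3
    have hi1 := hi.succ_of_col hv hY2 b4
    obtain ⟨t, t1, t2, t3, t4, -⟩ := id hi
    have c1 := hcross z j t (by omega) (by omega) hj t1 (by omega) t4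
    have c2 := hw' t t1 (by omega)
    refine ⟨i - z, by omega, ⟨j, hj, ?_, by omega⟩, ⟨j + 1, hj1, ?_, by omega⟩⟩
    · have : z + (i - z) = i := by omega
      rw [this]; exact hi
    · have : z + 1 + (i - z) = i + 1 := by omega
      rw [this]; exact hi1
  -- Separation is only assumed strictly after `p`, so `p` becomes an additional cut.
  have hrun := length_lz_reverse_frag_le (X := X) (l := p) (r := r) (F := insert p N) hp hr (by
    intro i j hi hij hj hfree
    have hpi : p < i := by
      rcases Nat.lt_or_ge p i with h | h
      · exact h
      · exact absurd (Finset.mem_insert.2 (Or.inl (by omega))) (hfree i le_rfl hij)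
    have hcont : ∀ z, i ≤ z → z < j → ∃ d, 0 < d ∧ C z d ∧ C (z + 1) d := by
      intro z h1 h2
      by_contra hcon
      exact hfree z h1 h2 (Finset.mem_insert_of_mem
        (Finset.mem_filter.2 ⟨Finset.mem_Ico.2 ⟨by omega, by omega⟩, hcon⟩))
    obtain ⟨d, d0, d1, -⟩ := hcont i le_rfl hij
    have key : ∀ z, i ≤ z → z ≤ j → C z d := by
      intro z hz
      induction z, hz using Nat.le_induction with
      | base => intro _; exact d1
      | succ z hz ih =>
        intro hz'
        obtain ⟨d', -, e1, e2⟩ := hcont z hz (by omega)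
        rw [hCuniq z d d' (ih (by omega)) e1]
        exact e2
    refine ⟨d, d0, ?_, ?_⟩
    · obtain ⟨_, _, _, h⟩ := key j hij.le le_rfl
      exact h
    · intro z h1 h2
      obtain ⟨j', ⟨_, _, _, _, _, _, _, e1⟩, ⟨_, _, _, _, _, _, _, e2⟩, -⟩ := key z h1 h2
      exact e1.2.2.trans e2.2.2.symm)
  have e1 := Finset.card_insert_le p N
  have e2 := Finset.card_le_card hsub
  have e3 := Finset.card_union_le (Finset.Ico (r - 1 - (w + w')) (r - 1) ∪
      (B.image x ∪ B.image (fun t => x t - 1))) (F3 ∪ F4)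
  have e4 := Finset.card_union_le (Finset.Ico (r - 1 - (w + w')) (r - 1))
      (B.image x ∪ B.image (fun t => x t - 1))
  have e5 := Finset.card_union_le (B.image x) (B.image (fun t => x t - 1))
  have e6 := Finset.card_union_le F3 F4
  have e7 : (B.image x).card ≤ B.card := Finset.card_image_le
  have e8 : (B.image (fun t => x t - 1)).card ≤ B.card := Finset.card_image_le
  rw [Nat.card_Ico] at e4
  omega

end Paths
-- Disjoint pairs of walks and simple fragments.
section Crossing

variable {α : Type*} {X Y : List α} {m n : ℕ} {x y u v : ℕ → ℕ}

/-- To change sides between consecutive rows, `v` would have to jump by at least two in one step. -/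
theorem above_succ (hu : IsCompleteWalk n X u) (hv : IsCompleteWalk n Y v) {i j i' j' : ℕ}
    (hi : 1 ≤ i) (hi' : i' ≤ X.length + 1)
    (hstep : (i' = i ∨ i' = i + 1) ∧ (j' = j ∨ j' = j + 1))
    (hoff : ∀ t, 1 ≤ t → t ≤ n + 1 → ¬ (u t = i' ∧ v t = j'))
    (h : ∀ t, 1 ≤ t → t ≤ n + 1 → u t = i → v t < j) :
    ∀ t, 1 ≤ t → t ≤ n + 1 → u t = i' → v t < j' := by
  rcases hstep.1 with h1 | h1
  · subst h1
    intro t a b c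
    have := h t a b c
    omega
  · rcases above_or_below hu hv hoff with h2 | h2
    · exact h2
    · exfalso
      obtain ⟨t, t1, t2, t3, t4⟩ := hu.exists_step (a := 1) (i := i) le_rfl (by omega)
        (by rw [hu.1]; exact hi) (by omega)
      have a1 := h t t1 (by omega) t3
      have a2 := h2 (t + 1) (by omega) (by omega) (by omega)
      rcases hv.2.2 t (Finset.mem_Icc.2 ⟨t1, t2⟩) with h3 | h3 <;> omega

/-- Here monotonicity of `v` gives `j' ≤ v t`, and avoiding the point makes this strict. -/
theorem below_succ (hu : IsCompleteWalk n X u) (hv : IsCompleteWalk n Y v) {i j i' j' : ℕ}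
    (hi : 1 ≤ i) (hi' : i' ≤ X.length + 1)
    (hstep : (i' = i ∨ i' = i + 1) ∧ (j' = j ∨ j' = j + 1))
    (hoff : ∀ t, 1 ≤ t → t ≤ n + 1 → ¬ (u t = i' ∧ v t = j'))
    (h : ∀ t, 1 ≤ t → t ≤ n + 1 → u t = i → j < v t) :
    ∀ t, 1 ≤ t → t ≤ n + 1 → u t = i' → j' < v t := by
  intro t t1 t2 t3
  have a2 : v t ≠ j' := fun h => hoff t t1 t2 ⟨t3, h⟩
  rcases hstep.1 with h1 | h1
  · subst h1
    have := h t t1 t2 t3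
    omega
  · obtain ⟨s, s1, s2, s3, s4⟩ := hu.exists_step (a := 1) (i := i) le_rfl (by omega)
      (by rw [hu.1]; exact hi) (by omega)
    have a1 := h s s1 (by omega) s3
    have h4 : s ≤ t := by
      by_contra hcon
      have := hu.mono t1 (not_le.1 hcon).le (by omega)
      omega
    have := hv.mono s1 h4 t2
    omega

/-- If `(x, y)` and `(u, v)` have no common point at the positions of `X` strictly between `p` and
`r`, then one of them runs strictly above the other one there. -/
theorem above_or_below_of_disjoint (hx : IsCompleteWalk m X x) (hy : IsCompleteWalk m Y y)
    (hu : IsCompleteWalk n X u) (hv : IsCompleteWalk n Y v) {p r : ℕ}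
    (hr : r ≤ X.length + 1)
    (hoff : ∀ t, 1 ≤ t → t ≤ m + 1 → p < x t → x t < r →
      ∀ s, 1 ≤ s → s ≤ n + 1 → ¬ (u s = x t ∧ v s = y t)) :
    (∀ t, 1 ≤ t → t ≤ m + 1 → p < x t → x t < r →
      ∀ s, 1 ≤ s → s ≤ n + 1 → u s = x t → v s < y t) ∨
    (∀ t, 1 ≤ t → t ≤ m + 1 → p < x t → x t < r →
      ∀ s, 1 ≤ s → s ≤ n + 1 → u s = x t → y t < v s) := by
  by_cases hpr : p + 1 < r
  swap
  · left; intros; omega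
  obtain ⟨h1, h2, h3, h4⟩ := hx.firstHit_spec (q := p + 1) (by omega) (by omega)
  set t₀ := firstHit m x (p + 1)
  have hstep : ∀ t, 1 ≤ t → t ≤ m → (x (t + 1) = x t ∨ x (t + 1) = x t + 1) ∧
      (y (t + 1) = y t ∨ y (t + 1) = y t + 1) := fun t a b =>
    ⟨hx.2.2 t (Finset.mem_Icc.2 ⟨a, b⟩), hy.2.2 t (Finset.mem_Icc.2 ⟨a, b⟩)⟩
  have hmono : ∀ t, t₀ ≤ t → t ≤ m + 1 → p < x t := fun t a b => by
    have := hx.mono h1 a b; omega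
  rcases above_or_below hu hv (hoff t₀ h1 h2 (by omega) (by omega)) with h | h
  · left
    intro t t1 t2 t3
    have ht : t₀ ≤ t := h4 t t1 t2 t3
    clear t1 t3
    induction t, ht using Nat.le_induction with
    | base => intro _; exact h
    | succ t ht ih =>
      intro t4
      have := hx.mono (a := t) (b := t + 1) (by omega) (by omega) t2
      exact above_succ hu hv (hx.one_le (by omega) (by omega)) (hx.le_length (by omega) t2)
        (hstep t (by omega) (by omega))
        (hoff (t + 1) (by omega) t2 (hmono _ (by omega) t2) t4)
        (ih (by omega) (by omega))
  · right
    intro t t1 t2 t3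
    have ht : t₀ ≤ t := h4 t t1 t2 t3
    clear t1 t3
    induction t, ht using Nat.le_induction with
    | base => intro _; exact h
    | succ t ht ih =>
      intro t4
      have := hx.mono (a := t) (b := t + 1) (by omega) (by omega) t2
      exact below_succ hu hv (hx.one_le (by omega) (by omega)) (hx.le_length (by omega) t2)
        (hstep t (by omega) (by omega))
        (hoff (t + 1) (by omega) t2 (hmono _ (by omega) t2) t4)
        (ih (by omega) (by omega))

variable [DecidableEq α]

theorem card_breakTimesIn_le {p r p' r' : ℕ} (hp : p ≤ p') (hr : r' ≤ r) :
    (breakTimesIn X Y m x y p' r').card ≤ (breakTimesIn X Y m x y p r).card :=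
  Finset.card_le_card (Finset.monotone_filter_right _ (fun a _ h => ⟨by omega, by omega⟩))

/-- Fragments of `X` on which the two walk pairs are disjoint have simple reversed fragments. -/
theorem isSimple_of_disjoint (hx : IsCompleteWalk m X x) (hy : IsCompleteWalk m Y y)
    (hu : IsCompleteWalk n X u) (hv : IsCompleteWalk n Y v) {p r w k : ℕ} (hp : 1 ≤ p)
    (hr : r ≤ X.length + 1)
    (hw : ∀ t, 1 ≤ t → t ≤ m + 1 → x t ≤ y t + w ∧ y t ≤ x t + w)
    (hk : (breakTimes X Y n u v).card ≤ k)
    (hoff : ∀ t, 1 ≤ t → t ≤ m + 1 → p < x t → x t < r →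
      ∀ s, 1 ≤ s → s ≤ n + 1 → ¬ (u s = x t ∧ v s = y t)) :
    IsSimple (w + 3 * k + 2 * (breakTimesIn X Y m x y p r).card + 2) X p r := by
  intro l q h1 h2 h3
  have c1 := card_breakTimesIn_le (X := X) (Y := Y) (m := m) (x := x) (y := y) h1 h3
  have c2 : (breakTimesIn X Y n u v l q).card ≤ (breakTimes X Y n u v).card :=
    Finset.card_filter_le _ _
  have hw' : ∀ t, 1 ≤ t → t ≤ n + 1 → u t ≤ v t + k ∧ v t ≤ u t + k := fun t a b => by
    have := dist_le_card_breakTimes hu hv a b; omega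
  -- The estimate is symmetric in the two pairs. The pair `(u, v)` contributes at most `k` through
  -- its width and `2 * k` through its breaks.
  rcases above_or_below_of_disjoint hx hy hu hv hr hoff with h | h
  · have := length_lz_le_of_above hx hy hu hv (p := l) (r := q) (w := w) (w' := k) (by omega)
      (by omega)
      (fun s t a b c d e f g => h s a b (by omega) (by omega) t c d g) (fun t a b => (hw t a b).2)
      (fun t a b => (hw' t a b).1)
    omega
  · have := length_lz_le_of_above hu hv hx hy (p := l) (r := q) (w := k) (w' := w) (by omega)
      (by omega)
      (fun s t a b c d e f g => h t c d (by omega) (by omega) s a b g.symm)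
      (fun t a b => (hw' t a b).2)
      (fun t a b => (hw t a b).1)
    omega

end Crossing

/-! ### Alignments as lists versus pairs of walks. -/

section Lists

/-- The list consists of the values of `f` at `1, …, n + 1`, without repetitions of consecutive
values. -/
def ListsValues (A : List (ℕ × ℕ)) (n : ℕ) (f : ℕ → ℕ × ℕ) : Prop :=
  (∀ p, p ∈ A ↔ ∃ t, 1 ≤ t ∧ t ≤ n + 1 ∧ f t = p) ∧
  ∀ p q, (p, q) ∈ A.zip A.tail ↔ ∃ t, 1 ≤ t ∧ t ≤ n ∧ f t = p ∧ f (t + 1) = q ∧ p ≠ q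

/-- By `hf`, a value that has been left never returns, so `dedup` removes only consecutive
repetitions and keeps the steps of `f` intact. -/
theorem dedup_map_range' {β : Type*} [DecidableEq β] {f : ℕ → β} {R : β → β → Prop} {N : ℕ}
    (hf : ∀ a b, a < b → b ≤ N → f a ≠ f (a + 1) → f a ≠ f b)
    (hR : ∀ a, a < N → f a ≠ f (a + 1) → R (f a) (f (a + 1))) (n : ℕ) :
    ∀ s, s + n ≤ N →
      ((List.range' s (n + 1)).map f).dedup.head? = some (f s) ∧
      ((List.range' s (n + 1)).map f).dedup.getLast? = some (f (s + n)) ∧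
      ((List.range' s (n + 1)).map f).dedup.IsChain R ∧
      ∀ p q, (p, q) ∈ ((List.range' s (n + 1)).map f).dedup.zip
        ((List.range' s (n + 1)).map f).dedup.tail ↔
        ∃ t, s ≤ t ∧ t < s + n ∧ f t = p ∧ f (t + 1) = q ∧ p ≠ q := by
  induction n with
  | zero =>
    intro s _
    have hd : [f s].dedup = [f s] := List.dedup_eq_self.2 (List.nodup_singleton _)
    rw [zero_add, List.range'_one, List.map_cons, List.map_nil, hd]
    refine ⟨rfl, rfl, by simp, ?_⟩
    intro p q
    simp only [List.tail_cons, List.zip_nil_right, List.not_mem_nil, false_iff]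
    rintro ⟨t, h1, h2, -⟩
    omega
  | succ n ih =>
    intro s hs
    obtain ⟨h1, h2, h3, h4⟩ := ih (s + 1) (by omega)
    rw [List.range'_succ, List.map_cons]
    set l := (List.range' (s + 1) (n + 1)).map f with hl
    have e : s + 1 + n = s + (n + 1) := by omega
    rw [e] at h2 h4
    by_cases hfs : f s = f (s + 1)
    · have hmem : f s ∈ l := by
        rw [hfs]
        exact List.mem_map_of_mem (by simp)
      rw [List.dedup_cons_of_mem hmem, h1, h2]
      refine ⟨by rw [hfs], rfl, h3, ?_⟩
      intro p q
      rw [h4]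
      constructor
      · rintro ⟨t, a, b⟩
        exact ⟨t, by omega, b⟩
      · rintro ⟨t, a, b, c, d, g⟩
        refine ⟨t, ?_, b, c, d, g⟩
        by_contra hcon
        have : t = s := by omega
        subst this
        exact g (by rw [← c, ← d, hfs])
    · have hmem : f s ∉ l := by
        intro hmem
        obtain ⟨b, hb, hb'⟩ := List.mem_map.1 hmem
        rw [List.mem_range'_1] at hb
        exact hf s b (by omega) (by omega) hfs hb'.symm
      rw [List.dedup_cons_of_notMem hmem]
      obtain ⟨rest, hrest⟩ : ∃ rest, l.dedup = f (s + 1) :: rest := by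
        cases hd : l.dedup with
        | nil => rw [hd] at h1; cases h1
        | cons a rest =>
          rw [hd, List.head?_cons, Option.some.injEq] at h1
          exact ⟨rest, by rw [h1]⟩
      rw [hrest] at h2 h3 h4 ⊢
      refine ⟨rfl, ?_, ?_, ?_⟩
      · rw [List.getLast?_cons_cons, h2]
      · rw [List.isChain_cons_cons]
        exact ⟨hR s (by omega) hfs, h3⟩
      · intro p q
        rw [List.tail_cons, List.zip_cons_cons, List.mem_cons]
        rw [List.tail_cons] at h4
        rw [h4, Prod.mk.injEq]
        constructor
        · rintro (⟨rfl, rfl⟩ | ⟨t, a, b⟩)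
          · exact ⟨s, le_rfl, by omega, rfl, rfl, hfs⟩
          · exact ⟨t, by omega, b⟩
        · rintro ⟨t, a, b, c, d, g⟩
          by_cases hts : t = s
          · subst hts
            exact Or.inl ⟨c.symm, d.symm⟩
          · exact Or.inr ⟨t, by omega, b, c, d, g⟩

variable {α : Type*} {X Y : List α} {m n : ℕ} {x y u v : ℕ → ℕ}

theorem eq_of_eq_later (hx : IsCompleteWalk m X x) (hy : IsCompleteWalk m Y y) {a b : ℕ}
    (ha : 1 ≤ a) (hab : a < b) (hb : b ≤ m + 1) (h1 : x a = x b) (h2 : y a = y b) :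
    x (a + 1) = x a ∧ y (a + 1) = y a := by
  have c1 := hx.mono (a := a) (b := a + 1) ha (by omega) (by omega)
  have c2 := hx.mono (a := a + 1) (b := b) (by omega) hab hb
  have c3 := hy.mono (a := a) (b := a + 1) ha (by omega) (by omega)
  have c4 := hy.mono (a := a + 1) (b := b) (by omega) hab hb
  omega

theorem zipAlignment_spec (hx : IsCompleteWalk m X x) (hy : IsCompleteWalk m Y y) :
    IsAlignment X Y (zipAlignment m x y) ∧
      ListsValues (zipAlignment m x y) m (fun t => (x t, y t)) := by
  -- The list lemma also quantifies over index `0`, where walks are arbitrary; `(0, 0)` is a value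
  -- that no complete walk pair takes later.
  set g : ℕ → ℕ × ℕ := fun t => if t = 0 then (0, 0) else (x t, y t) with hg
  have hg' : ∀ t, 1 ≤ t → g t = (x t, y t) := fun t ht => by
    simp only [hg]; rw [if_neg (by omega)]
  have hz : zipAlignment m x y = ((List.range' 1 (m + 1)).map g).dedup := by
    rw [zipAlignment]
    congr 1
    apply List.map_congr_left
    intro t ht
    rw [List.mem_range'_1] at ht
    rw [hg' t ht.1]
  obtain ⟨h1, h2, h3, h4⟩ := dedup_map_range' (f := g) (R := fun p q => p = (0, 0) ∨ AlignStep p q)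
    (N := m + 1) (by
      intro a b hab hb hne heq
      rcases Nat.eq_zero_or_pos a with rfl | ha
      · rw [hg' b (by omega)] at heq
        simp only [hg, if_true, Prod.mk.injEq] at heq
        have := hx.one_le (a := b) (by omega) hb
        omega
      · rw [hg' a ha, hg' b (by omega), Prod.mk.injEq] at heq
        have := eq_of_eq_later hx hy ha hab hb heq.1 heq.2
        rw [hg' a ha, hg' (a + 1) (by omega), this.1, this.2] at hne
        exact hne rfl) (by
      intro a ha hne
      rcases Nat.eq_zero_or_pos a with rfl | ha'
      · left; simp [hg]
      · right
        rw [hg' a ha', hg' (a + 1) (by omega)] at hne ⊢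
        rw [AlignStep]
        rcases hx.2.2 a (Finset.mem_Icc.2 ⟨ha', by omega⟩) with a1 | a1 <;>
        rcases hy.2.2 a (Finset.mem_Icc.2 ⟨ha', by omega⟩) with a2 | a2 <;>
        simp [a1, a2] at hne ⊢) m 1 (by omega)
  rw [← hz] at h1 h2 h3 h4
  have hmem : ∀ p, p ∈ zipAlignment m x y ↔ ∃ t, 1 ≤ t ∧ t ≤ m + 1 ∧ (x t, y t) = p := by
    intro p
    rw [zipAlignment, List.mem_dedup, List.mem_map]
    simp only [List.mem_range'_1]
    constructor
    · rintro ⟨t, a, b⟩; exact ⟨t, a.1, by omega, b⟩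
    · rintro ⟨t, a, b, c⟩; exact ⟨t, ⟨a, by omega⟩, c⟩
  refine ⟨⟨?_, ?_, ?_⟩, hmem, ?_⟩
  · rw [h1, hg' 1 le_rfl, hx.1, hy.1]
  · rw [h2, hg' (1 + m) (by omega), Nat.add_comm, hx.2.1, hy.2.1]
  · refine List.IsChain.imp_of_mem_imp ?_ h3
    intro p q hp hq hpq
    rcases hpq with h | h
    · obtain ⟨t, a, b, c⟩ := (hmem p).1 hp
      have := hx.one_le a b
      rw [h, Prod.mk.injEq] at c
      omega
    · exact h
  · intro p q
    rw [h4]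
    constructor
    · rintro ⟨t, a, b, c, d, e⟩
      exact ⟨t, a, by omega, by rw [← c, hg' t a], by rw [← d, hg' _ (by omega)], e⟩
    · rintro ⟨t, a, b, c, d, e⟩
      exact ⟨t, a, by omega, by rw [← c, hg' t a], by rw [← d, hg' _ (by omega)], e⟩

/-- Every alignment is given by a pair of complete walks. -/
theorem exists_walks_of_isAlignment {A : List (ℕ × ℕ)} (hA : IsAlignment X Y A) :
    ∃ (n : ℕ) (u v : ℕ → ℕ), IsCompleteWalk n X u ∧ IsCompleteWalk n Y v ∧
      ListsValues A n (fun t => (u t, v t)) := by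
  obtain ⟨h1, h2, h3⟩ := hA
  rw [List.isChain_iff_getElem] at h3
  have hlen : 0 < A.length := by
    cases A with
    | nil => cases h1
    | cons a l => simp
  rw [List.head?_eq_getElem?] at h1
  rw [List.getLast?_eq_getElem?] at h2
  set f : ℕ → ℕ × ℕ := fun t => A.getD (t - 1) (0, 0) with hf
  have hf' : ∀ t, ∀ h : t < A.length, f (t + 1) = A[t] := by
    intro t h
    simp [hf, List.getD_eq_getElem?_getD, h]
  have hf0 : f 1 = (1, 1) := by simp [hf, List.getD_eq_getElem?_getD, h1]
  have hfn : f (A.length - 1 + 1) = (X.length + 1, Y.length + 1) := by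
    simp only [hf, List.getD_eq_getElem?_getD, Nat.add_sub_cancel, h2, Option.getD_some]
  have hstep : ∀ t, 1 ≤ t → t ≤ A.length - 1 → AlignStep (f t) (f (t + 1)) := by
    intro t a b
    have := h3 (t - 1) (by omega)
    rw [← hf' (t - 1) (by omega), ← hf' (t - 1 + 1) (by omega)] at this
    have e : t - 1 + 1 = t := by omega
    rwa [e] at this
  have hne : ∀ p q, AlignStep p q → p ≠ q := by
    rintro ⟨a, b⟩ q h rfl
    simp [AlignStep] at h
  refine ⟨A.length - 1, fun t => (f t).1, fun t => (f t).2, ⟨by simp only [hf0],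
    by simp only [hfn], ?_⟩, ⟨by simp only [hf0], by simp only [hfn], ?_⟩, ?_, ?_⟩
  · intro t ht
    rw [Finset.mem_Icc] at ht
    rcases hstep t ht.1 ht.2 with h | h | h <;> simp [h]
  · intro t ht
    rw [Finset.mem_Icc] at ht
    rcases hstep t ht.1 ht.2 with h | h | h <;> simp [h]
  · intro p
    rw [List.mem_iff_getElem]
    constructor
    · rintro ⟨i, hi, rfl⟩
      exact ⟨i + 1, by omega, by omega, hf' i hi⟩
    · rintro ⟨t, a, b, c⟩
      refine ⟨t - 1, by omega, ?_⟩
      rw [← hf' (t - 1) (by omega), ← c]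
      have e : t - 1 + 1 = t := by omega
      rw [e]
  · intro p q
    rw [List.mem_iff_getElem]
    constructor
    · rintro ⟨i, hi, h⟩
      rw [List.length_zip, List.length_tail] at hi
      rw [List.getElem_zip, List.getElem_tail, Prod.mk.injEq] at h
      rw [← hf' i (by omega), ← hf' (i + 1) (by omega)] at h
      refine ⟨i + 1, by omega, by omega, h.1, h.2, ?_⟩
      rw [← h.1, ← h.2]
      exact hne _ _ (hstep (i + 1) (by omega) (by omega))
    · rintro ⟨t, a, b, c, d, -⟩
      refine ⟨t - 1, by rw [List.length_zip, List.length_tail]; omega, ?_⟩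
      rw [List.getElem_zip, List.getElem_tail, ← hf' (t - 1) (by omega),
        ← hf' (t - 1 + 1) (by omega)]
      have e : t - 1 + 1 = t := by omega
      rw [e, ← c, ← d]

theorem mem_matchSet_iff {A : List (ℕ × ℕ)} (hA : ListsValues A n (fun t => (u t, v t)))
    {i j : ℕ} : (i, j) ∈ matchSet X Y A ↔ IsMatch X Y n u v i j := by
  constructor
  · rintro ⟨q, h1, h2, h3⟩
    obtain ⟨t, a, b, c, d, -⟩ := (hA.2 _ _).1 h1
    simp only [Prod.mk.injEq] at c
    simp only [h2, Prod.mk.injEq] at d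
    exact ⟨t, a, b, c.1, c.2, d.1, d.2, h3⟩
  · rintro ⟨t, a, b, c, d, e, f, g⟩
    refine ⟨(i + 1, j + 1), (hA.2 _ _).2 ⟨t, a, b, ?_, ?_, ?_⟩, rfl, g⟩
    · simp only [c, d]
    · simp only [e, f]
    · simp

theorem dist_le_width (hx : IsCompleteWalk m X x) (hy : IsCompleteWalk m Y y) {t : ℕ}
    (ht : 1 ≤ t) (ht' : t ≤ m + 1) : x t ≤ y t + width (zipAlignment m x y) ∧
      y t ≤ x t + width (zipAlignment m x y) := by
  have h := (zipAlignment_spec hx hy).2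
  have : ((x t : ℤ) - (y t : ℤ)).natAbs ≤ width (zipAlignment m x y) :=
    Finset.le_sup (f := fun p : ℕ × ℕ => ((p.1 : ℤ) - (p.2 : ℤ)).natAbs)
      (List.mem_toFinset.2 ((h.1 (x t, y t)).2 ⟨t, ht, ht', rfl⟩))
  omega

variable [DecidableEq α]

/-- A monotone pair leaves each point only once, so a point left by a break is not also left by a
match. -/
theorem mem_breakSet_of_mem_breakTimes (hu : IsCompleteWalk n X u) (hv : IsCompleteWalk n Y v)
    {A : List (ℕ × ℕ)} (hA : ListsValues A n (fun t => (u t, v t))) {t : ℕ}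
    (ht : t ∈ breakTimes X Y n u v) : (u t, v t) ∈ breakSet X Y A := by
  rw [mem_breakTimes] at ht
  obtain ⟨⟨h1, h2⟩, h3, h4⟩ := ht
  refine ⟨(hA.1 _).2 ⟨t, h1, by omega, rfl⟩, ?_⟩
  rw [mem_matchSet_iff hA]
  rintro ⟨s, a, b, c, d, e, f, g⟩
  rcases lt_trichotomy t s with h | h | h
  · exact h3 (eq_of_eq_later hu hv h1 h (by omega) c.symm d.symm)
  · subst h
    exact h4 ⟨e, f, g⟩
  · have := eq_of_eq_later hu hv a h (by omega) c d
    omega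

theorem not_sameChar_of_isGreedy (hu : IsCompleteWalk n X u) (hv : IsCompleteWalk n Y v)
    {A : List (ℕ × ℕ)} (hA : ListsValues A n (fun t => (u t, v t))) (hg : IsGreedy X Y A) {t : ℕ}
    (ht : t ∈ breakTimes X Y n u v) : ¬ SameChar X Y (u t, v t) :=
  hg _ (mem_breakSet_of_mem_breakTimes hu hv hA ht)

/-- Distinct breaks leave distinct points, hence give distinct non-matching steps of the list. -/
theorem card_breakTimes_le_cost (hu : IsCompleteWalk n X u) (hv : IsCompleteWalk n Y v)
    {A : List (ℕ × ℕ)} (hA : ListsValues A n (fun t => (u t, v t))) :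
    (breakTimes X Y n u v).card ≤ cost X Y A := by
  rw [cost, List.countP_eq_length_filter]
  refine le_trans ?_ (List.toFinset_card_le _)
  refine Finset.card_le_card_of_injOn (fun t => ((u t, v t), (u (t + 1), v (t + 1)))) ?_ ?_
  · intro t ht
    rw [Finset.mem_coe, mem_breakTimes] at ht
    rw [Finset.mem_coe, List.mem_toFinset, List.mem_filter]
    refine ⟨(hA.2 _ _).2 ⟨t, ht.1.1, ht.1.2, rfl, rfl, ?_⟩, ?_⟩
    · intro h
      rw [Prod.mk.injEq] at h
      exact ht.2.1 ⟨h.1.symm, h.2.symm⟩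
    · rw [decide_eq_true_eq, isMatchStep_iff]
      exact ht.2.2
  · intro t ht s hs hts
    rw [Finset.mem_coe, mem_breakTimes] at ht hs
    simp only [Prod.mk.injEq] at hts
    rcases lt_trichotomy t s with h | h | h
    · exact absurd (eq_of_eq_later hu hv ht.1.1 h (by omega) hts.1.1 hts.1.2) ht.2.1
    · exact h
    · exact absurd (eq_of_eq_later hu hv hs.1.1 h (by omega) hts.1.1.symm hts.1.2.symm) hs.2.1

theorem exists_walks_of_editDist_le (hx : IsCompleteWalk m X x) (hy : IsCompleteWalk m Y y)
    {k : ℕ} (hk : editDist X Y ≤ k) :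
    ∃ (n : ℕ) (u v : ℕ → ℕ), IsCompleteWalk n X u ∧ IsCompleteWalk n Y v ∧
      (breakTimes X Y n u v).card ≤ k := by
  -- The zip alignment shows that the set of costs is non-empty, so the infimum is attained.
  obtain ⟨A, hA, hc⟩ := Nat.sInf_mem (s := {n | ∃ A, IsAlignment X Y A ∧ cost X Y A = n})
    ⟨_, _, (zipAlignment_spec hx hy).1, rfl⟩
  obtain ⟨n, u, v, hu, hv, h⟩ := exists_walks_of_isAlignment hA
  exact ⟨n, u, v, hu, hv, (card_breakTimes_le_cost hu hv h).trans (hc.trans_le hk)⟩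

end Lists

/-! ### What differences of the encodings reveal. -/

section Encoding

variable {α : Type*} [DecidableEq α] {X Y S : List α} {m n k : ℕ} {x y s u v : ℕ → ℕ}

/-- The entry of the context encoding at index `t`. -/
def contextSymbol (k : ℕ) (S : List α) (m : ℕ) (s : ℕ → ℕ) (t : ℕ) : Symbol α :=
  if Stored k S m s t then
    (lz (dctx k S (s t)).reverse,
      s t - (if lastStored k S m s t = 0 then 0 else s (lastStored k S m s t)))
  else blank

theorem contextEncoding_apply (j : Fin m) :
    contextEncoding k S m s j = contextSymbol k S m s (j + 1) := rfl

theorem dctx_length {p : ℕ} (hp : 1 ≤ p) (hp' : p ≤ S.length + 1) :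
    (dctx k S p).length = dctxLen k S p := by
  have h1 := ctxLen_spec (k := k) hp hp'
  have h2 := ctxLen_spec (k := k) (hp.trans le_ctxEnd_self) h1.1
  rw [dctx, frag_length hp (by rw [add_dctxLen hp hp']; exact h2.1)]
  omega

/-- The double context of a position inside `S` is non-empty for `k ≥ 1`, and LZ77 is injective. -/
theorem contextSymbol_ne_blank (hs : IsCompleteWalk m S s) (hk : 1 ≤ k) {t : ℕ} (ht : t ≤ m + 1)
    (h : Stored k S m s t) : contextSymbol k S m s t ≠ blank := by
  intro hb
  rw [contextSymbol, if_pos h, blank, Prod.mk.injEq] at hb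
  have h1 := hs.one_le h.1 ht
  have h2 := congrArg List.length (lz_injective hb.1)
  rw [List.length_reverse, dctx_length h1 (by have := h.2.1; omega), List.length_nil] at h2
  have h3 := add_dctxLen (k := k) (S := S) h1 (by have := h.2.1; omega)
  have h4 := lt_ctxEnd hk h1 h.2.1
  have h5 := le_ctxEnd_self (k := k) (S := S) (p := ctxEnd k S (s t))
  omega

/-- A pair of walks without breaks between two indices runs along a diagonal. -/
theorem diagonal_of_no_breaks (hx : IsCompleteWalk m X x) (hy : IsCompleteWalk m Y y) {a b : ℕ}
    (ha : 1 ≤ a) (hab : a ≤ b) (hb : b ≤ m + 1)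
    (hfree : ∀ τ, a ≤ τ → τ < b → τ ∉ breakTimes X Y m x y) :
    x a ≤ x b ∧ x b + y a = y b + x a ∧
      ∀ z < x b - x a, X[x a - 1 + z]? = Y[y a - 1 + z]? := by
  have hxa := hx.one_le ha (hab.trans hb)
  have hya := hy.one_le ha (hab.trans hb)
  induction b, hab using Nat.le_induction with
  | base => exact ⟨le_rfl, by omega, fun z hz => by omega⟩
  | succ b hab ih =>
    obtain ⟨h1, h2, h3⟩ := ih (by omega) (fun τ a b => hfree τ a (by omega))
    rcases step_of_notMem_breakTimes (by omega) (by omega) (hfree b hab (by omega)) with h | h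
    · rw [h.1, h.2]
      exact ⟨h1, h2, h3⟩
    · refine ⟨by omega, by omega, ?_⟩
      intro z hz
      by_cases hz' : z < x b - x a
      · exact h3 z hz'
      · have h6 := h.2.2.2.2
        simp only at h6
        have e1 : x a - 1 + z = x b - 1 := by omega
        have e2 : y a - 1 + z = y b - 1 := by omega
        rw [e1, e2, h6]

/-- A position at which the zip alignment has a breakpoint is revealed, together with its whole
context. -/
theorem exists_revealing_index (hx : IsCompleteWalk m X x) (hy : IsCompleteWalk m Y y)
    (hk : 1 ≤ k) (hg : ∀ t ∈ breakTimes X Y m x y, ¬ SameChar X Y (x t, y t)) {t : ℕ}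
    (ht : 1 ≤ t) (ht' : t ≤ m + 1) (hxt : x t ≤ X.length) (hne : ¬ SameChar X Y (x t, y t)) {i : ℕ}
    (hi : x t ≤ i) (hi' : i < ctxEnd k X (x t)) : i ∈ revealed k X Y m x y := by
  -- As `x t` lies in the context at `x a`, the context at `x t` ends within the double context at
  -- `x a`.
  obtain ⟨a, a1, a2, a3, a4⟩ := exists_stored hx hk ht ht' hxt
  have am : a ≤ m := by
    by_contra hcon
    have e : a = m + 1 := by omega
    have := a3.2.1
    rw [e, hx.2.1] at this
    omega
  have b1 := hx.one_le a1 (by omega)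
  have b2 := hx.mono a1 a2 ht'
  have b3 := add_dctxLen (k := k) (S := X) b1 (by omega)
  have b4 := lt_ctxEnd_of_lt_nxt hx a1 (by omega) a3.2.1 ht a4
  have b5 := ctxLen_spec (k := k) b1 (by omega : x a ≤ X.length + 1)
  have b6 := ctxEnd_mono (k := k) (S := X) (by omega) b4.le b5.1
  have b7 := ctxLen_spec (k := k) (S := X) (p := x t) (by omega) (by omega)
  have ea : a - 1 + 1 = a := by omega
  refine ⟨⟨by omega, by omega⟩, ⟨a - 1, by omega⟩, ?_⟩
  rw [contextEncoding_apply, contextEncoding_apply]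
  simp only [ea]
  refine ⟨contextSymbol_ne_blank hx hk (by omega) a3, ?_, by omega, by omega⟩
  intro heq
  have hSY : Stored k Y m y a := by
    by_contra hcon
    have := contextSymbol_ne_blank hx hk (by omega) a3
    rw [heq, contextSymbol, if_neg hcon] at this
    exact this rfl
  rw [contextSymbol, contextSymbol, if_pos a3, if_pos hSY, Prod.mk.injEq] at heq
  have h1 : dctx k X (x a) = dctx k Y (y a) := List.reverse_injective (lz_injective heq.1)
  have c1 := hy.one_le a1 (by omega : a ≤ m + 1)
  have c2 := hSY.2.1
  have c3 := add_dctxLen (k := k) (S := Y) c1 (by omega)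
  have c5 := ctxLen_spec (k := k) c1 (by omega : y a ≤ Y.length + 1)
  have c6 := ctxLen_spec (k := k) (S := Y) (p := ctxEnd k Y (y a))
    (c1.trans le_ctxEnd_self) c5.1
  have h2 : dctxLen k X (x a) = dctxLen k Y (y a) := by
    rw [← dctx_length b1 (by omega), h1, dctx_length c1 (by omega)]
  rw [dctx, dctx, ← h2, frag_add_eq_iff] at h1
  -- Up to the first point with unequal characters, greediness excludes breaks. The pair arrives
  -- there on the diagonal of `(x a, y a)`, where the equal double contexts force equal characters.
  have hex : ∃ w, a ≤ w ∧ ¬ SameChar X Y (x w, y w) := ⟨t, a2, hne⟩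
  obtain ⟨d1, d2⟩ := Nat.find_spec hex
  have d3 : Nat.find hex ≤ t := Nat.find_min' hex ⟨a2, hne⟩
  set w := Nat.find hex with hw
  obtain ⟨e1, e2, -⟩ := diagonal_of_no_breaks hx hy a1 d1 (by omega) (by
    intro τ t1 t2 t3
    exact Nat.find_min hex (m := τ) (by omega) ⟨t1, hg τ t3⟩)
  have e3 := hx.mono (a := w) (b := t) (by omega) d3 ht'
  refine d2 ⟨⟨by omega, by omega⟩, ⟨by simp only; omega, by simp only; omega⟩, ?_⟩
  have := h1 (x w - x a) (by omega)
  have f1 : x a - 1 + (x w - x a) = x w - 1 := by omega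
  have f2 : y a - 1 + (x w - x a) = y w - 1 := by omega
  rwa [f1, f2] at this

/-- All breakpoints are revealed. -/
theorem breakPositions_subset_revealed (hx : IsCompleteWalk m X x) (hy : IsCompleteWalk m Y y)
    (hk : 1 ≤ k) (hg : IsGreedy X Y (zipAlignment m x y)) :
    breakPositions X Y (zipAlignment m x y) ⊆ revealed k X Y m x y := by
  rintro i ⟨⟨hi, hi'⟩, j, hj⟩
  have hA := (zipAlignment_spec hx hy).2
  obtain ⟨t, t1, t2, t3⟩ := (hA.1 _).1 hj.1
  simp only [Prod.mk.injEq] at t3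
  have hne := hg _ hj
  rw [← t3.1, ← t3.2] at hne
  have := lt_ctxEnd (S := X) hk (by omega : 1 ≤ x t) (by omega)
  exact exists_revealing_index hx hy hk (fun t ht => not_sameChar_of_isGreedy hx hy hA hg ht) t1 t2
    (by omega) hne (by omega) (by omega)

/-- All positions of `X` at which a greedy alignment of small cost diverges from
the zip alignment are revealed. -/
theorem divergence_subset_revealed (hx : IsCompleteWalk m X x) (hy : IsCompleteWalk m Y y)
    (hg : IsGreedy X Y (zipAlignment m x y)) {k' : ℕ} (hk : 1 ≤ k)
    (hk' : width (zipAlignment m x y) + 5 * k ≤ k') {A : List (ℕ × ℕ)}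
    (hA : A ∈ greedyAlignments k X Y) :
    divergence X Y A (zipAlignment m x y) ⊆ revealed k' X Y m x y := by
  rintro i ⟨⟨hi, hi'⟩, hdiv⟩
  have hW := (zipAlignment_spec hx hy).2
  have hgW : ∀ t ∈ breakTimes X Y m x y, ¬ SameChar X Y (x t, y t) :=
    fun t ht => not_sameChar_of_isGreedy hx hy hW hg ht
  obtain ⟨hA1, hA2, hA3⟩ := hA
  obtain ⟨n, u, v, hu, hv, hAl⟩ := exists_walks_of_isAlignment hA1
  have hgA : ∀ t ∈ breakTimes X Y n u v, ¬ SameChar X Y (u t, v t) :=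
    fun t ht => not_sameChar_of_isGreedy hu hv hAl hA2 ht
  have hcost := (card_breakTimes_le_cost hu hv hAl).trans hA3
  have hone : 1 ≤ k' := by omega
  by_cases hrow : ∃ t, 1 ≤ t ∧ t ≤ m + 1 ∧ x t = i ∧ ¬ SameChar X Y (x t, y t)
  · obtain ⟨t, t1, t2, t3, t4⟩ := hrow
    have := lt_ctxEnd (S := X) hone hi hi'
    exact exists_revealing_index hx hy hone hgW t1 t2 (by omega) t4 (by omega) (by rw [t3]; omega)
  push Not at hrow
  obtain ⟨e, e1, e2, e3, e4⟩ := hx.exists_step (a := 1) (i := i) le_rfl (by omega)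
    (by rw [hx.1]; exact hi) hi'
  have hsame : SameChar X Y (x e, y e) := hrow e e1 (by omega) e3
  have hstep : ∀ t, 1 ≤ t → t ≤ m → SameChar X Y (x t, y t) →
      (x (t + 1) = x t ∧ y (t + 1) = y t) ∨ (x (t + 1) = x t + 1 ∧ y (t + 1) = y t + 1) := by
    intro t a b c
    rcases step_of_notMem_breakTimes a b (fun h => hgW t h c) with h | h
    · exact Or.inl h
    · exact Or.inr ⟨h.1, h.2.1⟩
  have hmatchA : ∀ w, 1 ≤ w → w ≤ n + 1 → SameChar X Y (u w, v w) →
      IsMatch X Y n u v (u w) (v w) := by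
    intro w w1 w2 hw
    have hul := hw.1.2
    simp only at hul
    by_contra hcon
    have key : ∀ b, w ≤ b → b ≤ n + 1 → u b = u w ∧ v b = v w := by
      intro b hb
      induction b, hb using Nat.le_induction with
      | base => intro _; exact ⟨rfl, rfl⟩
      | succ b hb ih =>
        intro hbn
        obtain ⟨h1, h2⟩ := ih (by omega)
        rcases step_of_notMem_breakTimes (X := X) (Y := Y) (x := u) (y := v) (m := n) (t := b)
          (by omega) (by omega) (fun h => hgA b h (by rw [h1, h2]; exact hw)) with h | h
        · omega
        · exact absurd ⟨b, by omega, by omega, h1, h2, by omega, by omega, hw⟩ hcon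
    have := (key (n + 1) w2 le_rfl).1
    rw [hu.2.1] at this
    omega
  have hmatchW : IsMatch X Y m x y i (y e) := by
    rcases hstep e e1 e2 hsame with h | h
    · omega
    · exact ⟨e, e1, e2, e3, rfl, e4, h.2, e3 ▸ hsame⟩
  have hoffe : ∀ w, 1 ≤ w → w ≤ n + 1 → ¬ (u w = x e ∧ v w = y e) := by
    rintro w w1 w2 ⟨w3, w4⟩
    have := hmatchA w w1 w2 (by rw [w3, w4]; exact hsame)
    rw [w3, w4, e3] at this
    exact hdiv ⟨y e, (mem_matchSet_iff hAl).2 this, (mem_matchSet_iff hW).2 hmatchW⟩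
  -- From a common point with equal characters both greedy pairs follow the same match, so
  -- disjointness propagates backwards.
  have hback : ∀ t, 1 ≤ t → t ≤ e → (∀ τ, t ≤ τ → τ ≤ e → SameChar X Y (x τ, y τ)) →
      ∀ w, 1 ≤ w → w ≤ n + 1 → ¬ (u w = x t ∧ v w = y t) := by
    intro t t1 t2
    induction t2 using Nat.decreasingInduction with
    | self => intro _; exact hoffe
    | of_succ t h ih =>
      rintro hs w w1 w2 ⟨w3, w4⟩
      have ih := ih (by omega) (fun τ a b => hs τ (by omega) b)
      rcases hstep t t1 (by omega) (hs t le_rfl (by omega)) with h1 | h1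
      · exact ih w w1 w2 ⟨by omega, by omega⟩
      · obtain ⟨w', a1, a2, a3, a4, a5, a6, -⟩ := hmatchA w w1 w2 (by
          rw [w3, w4]; exact hs t le_rfl (by omega))
        exact ih (w' + 1) (by omega) (by omega) ⟨by omega, by omega⟩
  -- Otherwise disjointness would propagate back to the common start `(1, 1)`.
  have hex : ∃ σ, 1 ≤ σ ∧ σ ≤ e ∧ ¬ SameChar X Y (x σ, y σ) := by
    by_contra hcon
    push Not at hcon
    exact hback 1 le_rfl e1 hcon 1 le_rfl (by omega) ⟨by rw [hu.1, hx.1], by rw [hv.1, hy.1]⟩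
  obtain ⟨σ₀, hσ₀⟩ := hex
  set σ := Nat.findGreatest (fun σ => 1 ≤ σ ∧ σ ≤ e ∧ ¬ SameChar X Y (x σ, y σ)) e with hσ
  obtain ⟨s1, s2, s3⟩ : 1 ≤ σ ∧ σ ≤ e ∧ ¬ SameChar X Y (x σ, y σ) :=
    Nat.findGreatest_spec (P := fun σ => 1 ≤ σ ∧ σ ≤ e ∧ ¬ SameChar X Y (x σ, y σ)) hσ₀.2.1 hσ₀
  have hafter : ∀ τ, σ < τ → τ ≤ e → SameChar X Y (x τ, y τ) := by
    intro τ h1 h2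
    by_contra hcon
    exact Nat.findGreatest_is_greatest (P := fun σ => 1 ≤ σ ∧ σ ≤ e ∧ ¬ SameChar X Y (x σ, y σ))
      h1 h2 ⟨by omega, h2, hcon⟩
  have s4 := hx.mono s1 s2 (by omega)
  have s5 := hx.one_le s1 (by omega)
  have hwin : ∀ t, 1 ≤ t → t ≤ m + 1 → x σ < x t → x t < i + 1 → σ < t ∧ t ≤ e := by
    intro t t1 t2 t3 t4
    constructor
    · by_contra hcon
      have := hx.mono t1 (not_lt.1 hcon) (by omega)
      omega
    · by_contra hcon
      have := hx.mono (a := e + 1) (by omega) (not_le.1 hcon) t2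
      omega
  have hsimple := isSimple_of_disjoint hx hy hu hv (p := x σ) (r := i + 1) s5 (by omega)
    (fun t a b => dist_le_width hx hy a b) hcost (by
      intro t t1 t2 t3 t4
      obtain ⟨a, b⟩ := hwin t t1 t2 t3 t4
      exact hback t t1 b (fun τ c d => hafter τ (by omega) d))
  have hzero : breakTimesIn X Y m x y (x σ) (i + 1) = ∅ := by
    rw [breakTimesIn, Finset.filter_eq_empty_iff]
    rintro t ht ⟨h1, h2⟩
    have h3 := (mem_breakTimes.1 ht).1
    obtain ⟨a, b⟩ := hwin t h3.1 (by omega) h1 h2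
    exact hgW t ht (hafter t a b)
  rw [hzero, Finset.card_empty] at hsimple
  -- Without breaks the bound is `w + 3k + 2`, at most `k'` because `k ≥ 1`.
  have hend : i + 1 ≤ ctxEnd k' X (x σ) :=
    le_ctxEnd s5 (by omega) (by omega) (fun l r a b c => (hsimple l r a b c).trans (by omega))
  exact exists_revealing_index hx hy hone hgW s1 (by omega) (by omega) s3 (by omega) hend

end Encoding

/-! ### Stability of encoded symbols away from breaks. -/

section Stability

variable {α : Type*} [DecidableEq α] {X Y : List α} {m k : ℕ} {x y : ℕ → ℕ}

theorem IsSimple.transfer {p q c : ℕ} (hp : 1 ≤ p) (hq : 1 ≤ q) (hp' : p + c ≤ X.length + 1)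
    (hq' : q + c ≤ Y.length + 1) (h : ∀ z < c, X[p - 1 + z]? = Y[q - 1 + z]?)
    (hs : IsSimple k X p (p + c)) : IsSimple k Y q (q + c) := by
  have h1 := (maxLZrev_frag_le_iff hp (by omega) hp').2 hs
  rw [frag_add_eq_iff.2 h] at h1
  exact (maxLZrev_frag_le_iff hq (by omega) hq').1 h1

/-- If there are no breaks until the end of the double context, then the contexts agree. -/
theorem context_congr (hx : IsCompleteWalk m X x) (hy : IsCompleteWalk m Y y) (hk : 1 ≤ k) {t : ℕ}
    (ht : 1 ≤ t) (ht' : t ≤ m + 1) (hxt : x t ≤ X.length)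
    (hfree : ∀ τ, t ≤ τ → τ < (nxt k X m x)^[2] t → τ ∉ breakTimes X Y m x y) :
    y t ≤ Y.length ∧ ctxLen k X (x t) = ctxLen k Y (y t) ∧ nxt k Y m y t = nxt k X m x t := by
  set w := nxt k X m x t with hw
  have hiter : (nxt k X m x)^[2] t = nxt k X m x w := rfl
  rw [hiter] at hfree
  have a1 := lt_nxt hx hk ht ht' hxt
  have a2 := nxt_le (k := k) hx ht ht'
  rw [← hw] at a1 a2
  have a3 := le_nxt hx hk (t := w) (by omega) a2
  have a4 := nxt_le (k := k) hx (t := w) (by omega) a2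
  have b1 := hx.one_le ht ht'
  have b2 := hy.one_le ht ht'
  have b3 := lt_ctxEnd hk b1 hxt
  have b4 := ctxLen_spec (k := k) b1 (by omega : x t ≤ X.length + 1)
  have b5 : x w = ctxEnd k X (x t) := apply_nxt hx ht ht' hxt
  obtain ⟨c1, c2, c3⟩ := diagonal_of_no_breaks hx hy ht a1.le a2
    (fun τ h1 h2 => hfree τ h1 (by omega))
  obtain ⟨d1, d2, d3⟩ := diagonal_of_no_breaks hx hy ht (a1.le.trans a3) a4 hfree
  have e1 := hy.le_length (a := w) (by omega) a2
  have e2 := hy.le_length (a := nxt k X m x w) (by omega) a4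
  have hyt : y t ≤ Y.length := by omega
  have hc : ctxEnd k X (x t) = x t + ctxLen k X (x t) := rfl
  have hc' : ctxEnd k Y (y t) = y t + ctxLen k Y (y t) := rfl
  have hge : y t + ctxLen k X (x t) ≤ ctxEnd k Y (y t) := by
    refine le_ctxEnd b2 (by omega) (by omega) ?_
    exact IsSimple.transfer b1 b2 (by omega) (by omega) (fun z hz => c3 z (by omega)) b4.2
  have hspec := ctxLen_spec (k := k) b2 (by omega : y t ≤ Y.length + 1)
  -- A longer context in `Y` would transfer back to `X`, since the diagonal extends at least one
  -- character past the context of `X`. If that context ends at the end of `X`, the diagonal reaches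
  -- the end of both strings.
  have hle : ctxEnd k Y (y t) ≤ y t + ctxLen k X (x t) := by
    by_cases hend : ctxEnd k X (x t) ≤ X.length
    · by_contra hcon
      have f1 := apply_nxt (k := k) hx (t := w) (by omega) a2 (by omega)
      have f2 := lt_ctxEnd (S := X) hk (p := x w) (by omega) (by omega)
      have f3 := not_isSimple_of_ctxEnd b1 hend
      refine f3 ?_
      rw [hc, Nat.add_assoc]
      refine IsSimple.transfer b2 b1 (by omega) (by omega) (fun z hz => (d3 z (by omega)).symm)
        (hspec.2.mono le_rfl (by omega))
    · have f1 : nxt k X m x w = m + 1 := by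
        rw [nxt, if_neg (by omega)]
      rw [f1, hx.2.1, hy.2.1] at d2
      omega
  have hlen : ctxLen k X (x t) = ctxLen k Y (y t) := by omega
  refine ⟨hyt, hlen, ?_⟩
  have g1 := apply_nxt (k := k) hy ht ht' hyt
  have g2 := lt_nxt hy hk ht ht' hyt
  have g3 := nxt_le (k := k) hy ht ht'
  apply le_antisymm
  · by_contra hcon
    have := lt_ctxEnd_of_lt_nxt hy ht ht' hyt (v := w) (by omega) (not_le.1 hcon)
    omega
  · by_contra hcon
    have h1 := lt_ctxEnd_of_lt_nxt hx ht ht' hxt (v := nxt k Y m y t) (by omega) (not_le.1 hcon)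
    obtain ⟨h2, h3, -⟩ := diagonal_of_no_breaks hx hy ht g2.le g3
      (fun τ h1 h2 => hfree τ h1 (by omega))
    omega

/-- The double context is two successive contexts, and `context_congr` looks ahead two contexts from
the start of each, so three iterates of `nxt` must be free of breaks. -/
theorem dctx_congr (hx : IsCompleteWalk m X x) (hy : IsCompleteWalk m Y y) (hk : 1 ≤ k) {t : ℕ}
    (ht : 1 ≤ t) (ht' : t ≤ m + 1) (hxt : x t ≤ X.length)
    (hfree : ∀ τ, t ≤ τ → τ < (nxt k X m x)^[3] t → τ ∉ breakTimes X Y m x y) :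
    dctx k X (x t) = dctx k Y (y t) := by
  set w := nxt k X m x t with hw
  have hiter : (nxt k X m x)^[3] t = (nxt k X m x)^[2] w := rfl
  have hiter2 : (nxt k X m x)^[2] t = nxt k X m x w := rfl
  rw [hiter] at hfree
  have a1 := lt_nxt hx hk ht ht' hxt
  have a2 := nxt_le (k := k) hx ht ht'
  rw [← hw] at a1 a2
  have a3 := le_nxt hx hk (t := w) (by omega) a2
  have a4 := nxt_le (k := k) hx (t := w) (by omega) a2
  have a5 : nxt k X m x w ≤ (nxt k X m x)^[2] w := le_nxt hx hk (by omega) a4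
  obtain ⟨h1, h2, h3⟩ := context_congr hx hy hk ht ht' hxt
    (fun τ b1 b2 => hfree τ b1 (by omega))
  have b1 := hx.one_le ht ht'
  have b2 := hy.one_le ht ht'
  have b3 : x w = ctxEnd k X (x t) := apply_nxt hx ht ht' hxt
  have b4 : y w = ctxEnd k Y (y t) := by rw [hw, ← h3]; exact apply_nxt hy ht ht' h1
  have b5 := add_dctxLen (k := k) b1 (by omega : x t ≤ X.length + 1)
  have b6 := add_dctxLen (k := k) b2 (by omega : y t ≤ Y.length + 1)
  rw [← b3] at b5
  rw [← b4] at b6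
  obtain ⟨c1, c2, c3⟩ := diagonal_of_no_breaks hx hy ht (a1.le.trans a3) a4
    (fun τ h1 h2 => hfree τ h1 (by omega))
  obtain ⟨-, d2, -⟩ := diagonal_of_no_breaks hx hy ht a1.le a2
    (fun τ h1 h2 => hfree τ h1 (by omega))
  have e1 := hx.one_le (a := w) (by omega) a2
  have e2 := hy.one_le (a := w) (by omega) a2
  have e3 := hx.le_length (a := w) (by omega) a2
  have e4 := hy.le_length (a := w) (by omega) a2
  have key : ctxEnd k X (x w) = x (nxt k X m x w) ∧ ctxLen k X (x w) = ctxLen k Y (y w) := by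
    by_cases hend : x w ≤ X.length
    · exact ⟨(apply_nxt hx (by omega) a2 hend).symm, (context_congr hx hy hk (by omega) a2 hend
        (fun τ h1 h2 => hfree τ (by omega) h2)).2.1⟩
    · have f1 : nxt k X m x w = m + 1 := by rw [nxt, if_neg hend]
      have f2 := (ctxLen_spec (k := k) e1 e3).1
      have f3 := (ctxLen_spec (k := k) e2 e4).1
      have f4 := le_ctxEnd_self (k := k) (S := X) (p := x w)
      rw [f1, hx.2.1, hy.2.1] at c2
      have g1 : ctxEnd k X (x w) = x w + ctxLen k X (x w) := rfl
      have g2 : ctxEnd k Y (y w) = y w + ctxLen k Y (y w) := rfl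
      rw [f1, hx.2.1]
      omega
  have g1 : ctxEnd k X (x w) = x w + ctxLen k X (x w) := rfl
  have g2 : ctxEnd k Y (y w) = y w + ctxLen k Y (y w) := rfl
  have hl : dctxLen k X (x t) = dctxLen k Y (y t) := by omega
  rw [dctx, dctx, ← hl, frag_add_eq_iff]
  intro z hz
  exact c3 z (by omega)

theorem lastStored_eq (hy : IsCompleteWalk m Y y) (hk : 1 ≤ k) {t w : ℕ} (hw : 1 ≤ w) (hwt : w < t)
    (ht' : t ≤ m + 1) (hyt : y t ≤ Y.length) (h : Stored k Y m y w)
    (h' : ∀ z, w < z → z < t → ¬ Stored k Y m y z) : lastStored k Y m y t = w := by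
  obtain ⟨h1, h2, h3, h4⟩ := lastStored_spec hy hk (t := t) (by omega) ht' hyt
  rcases lt_trichotomy (lastStored k Y m y t) w with h5 | h5 | h5
  · exact absurd h (h4 w h5 hwt)
  · exact h5
  · exact absurd h3 (h' _ h5 h2)

/-- Encodings agree at a stored index if there are no breaks in its neighbourhood. -/
theorem contextSymbol_congr (hx : IsCompleteWalk m X x) (hy : IsCompleteWalk m Y y) (hk : 1 ≤ k)
    {t : ℕ} (ht' : t ≤ m + 1) (hst : Stored k X m x t)
    (hfree : ∀ τ, lastStored k X m x t ≤ τ + 1 → τ < (nxt k X m x)^[3] t →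
      τ ∉ breakTimes X Y m x y) :
    contextSymbol k X m x t = contextSymbol k Y m y t := by
  have ht := hst.1
  have hxt := hst.2.1
  have h32 : ∀ w, 1 ≤ w → w ≤ t → (nxt k X m x)^[2] w ≤ (nxt k X m x)^[3] t := by
    intro w w1 w2
    have h1 := nxt_iterate_mono hx hk 2 w1 w2 ht'
    have h2 := nxt_iterate_mem hx hk 2 ht ht'
    have h3 : (nxt k X m x)^[2] t ≤ (nxt k X m x)^[3] t := by
      rw [Function.iterate_succ_apply' _ 2]
      exact le_nxt hx hk (by omega) h2.2
    exact h1.trans h3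
  -- Being stored at `w` compares `muAt` at `w` and `w - 1`; hence the neighbourhood starts one
  -- index before the previous stored index.
  have hloc : ∀ w, lastStored k X m x t ≤ w + 1 → w ≤ t →
      muAt k X m x w = muAt k Y m y w ∧ (1 ≤ w → y w ≤ Y.length) := by
    intro w h1 h2
    rcases Nat.eq_zero_or_pos w with rfl | hw
    · simp [muAt]
    · have h3 := (hx.mono hw h2 ht').trans hxt
      obtain ⟨a, b, c⟩ := context_congr hx hy hk hw (by omega) h3
        (fun τ b1 b2 => hfree τ (by omega) (b2.trans_le (h32 w hw h2)))
      rw [muAt_eq hw h3, muAt_eq hw a, c]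
      exact ⟨rfl, fun _ => a⟩
  have hstored : ∀ w, lastStored k X m x t ≤ w → w ≤ t →
      (Stored k X m x w ↔ Stored k Y m y w) := by
    intro w h1 h2
    rcases Nat.eq_zero_or_pos w with rfl | hw
    · simp [Stored]
    · have a := hloc w (by omega) h2
      have b := hloc (w - 1) (by omega) (by omega)
      have c := (hx.mono hw h2 ht').trans hxt
      have d := a.2 hw
      rw [Stored, Stored, a.1, b.1]
      tauto
  have hlt : lastStored k X m x t ≤ t :=
    (Nat.findGreatest_le (P := fun u => Stored k X m x u) (t - 1)).trans (Nat.sub_le _ _)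
  have hyt := (hloc t (by omega) le_rfl).2 ht
  rw [contextSymbol, contextSymbol, if_pos hst, if_pos ((hstored t hlt le_rfl).1 hst),
    dctx_congr hx hy hk ht ht' hxt (fun τ b1 b2 => hfree τ (by omega) b2), Prod.mk.injEq]
  refine ⟨rfl, ?_⟩
  -- At `t = 1` there is no previous stored index and both walks are at `1`. Otherwise both have the
  -- same previous stored index, and the diagonal equates the increments.
  rcases Nat.lt_or_ge t 2 with h | h
  · have e : t = 1 := by omega
    subst e
    have e1 : lastStored k X m x 1 = 0 := by simp [lastStored]
    have e2 : lastStored k Y m y 1 = 0 := by simp [lastStored]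
    rw [e1, e2, if_pos rfl, if_pos rfl, hx.1, hy.1]
  · obtain ⟨h1, h2, h3, h4⟩ := lastStored_spec hx hk h ht' hxt
    have e : lastStored k Y m y t = lastStored k X m x t :=
      lastStored_eq hy hk h1 h2 ht' hyt ((hstored _ le_rfl h2.le).1 h3)
        (fun z z1 z2 hz => h4 z z1 z2 ((hstored z z1.le z2.le).2 hz))
    rw [e, if_neg (by omega), if_neg (by omega)]
    have h5 := (nxt_iterate_mem hx hk 3 ht ht').1
    obtain ⟨a, b, -⟩ := diagonal_of_no_breaks hx hy h1 h2.le ht'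
      (fun τ b1 b2 => hfree τ (by omega) (by omega))
    omega

end Stability

/-! ### Counting the differences of the encodings. -/

section Counting

/-- A predicate that holds initially becomes true again at most as often as it becomes false. -/
theorem card_rise_le_card_fall {P : ℕ → Prop} [DecidablePred P] (h1 : P 1) (m : ℕ) :
    ((Finset.Icc 1 m).filter (fun t => ¬ P t ∧ P (t + 1))).card ≤
      ((Finset.Icc 1 m).filter (fun t => P t ∧ ¬ P (t + 1))).card := by
  -- The exact balance: falls exceed rises by one precisely when `P` fails at the end.
  have key : ((Finset.Icc 1 m).filter (fun t => ¬ P t ∧ P (t + 1))).card +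
      (if P (m + 1) then 0 else 1) =
      ((Finset.Icc 1 m).filter (fun t => P t ∧ ¬ P (t + 1))).card := by
    induction m with
    | zero => simp [h1]
    | succ m ih =>
      rw [← Finset.insert_Icc_right_eq_Icc_add_one (by omega), Finset.filter_insert,
        Finset.filter_insert]
      by_cases a : P (m + 1) <;> by_cases b : P (m + 1 + 1) <;> simp [a, b] at ih ⊢ <;> omega
  omega

variable {α : Type*} {X Y : List α} {m n k k' w : ℕ} {x y u v : ℕ → ℕ}

theorem exists_move (hu : IsCompleteWalk n X u) (hv : IsCompleteWalk n Y v) {a : ℕ} (ha : 1 ≤ a)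
    (ha' : a ≤ n + 1) (hend : ¬ (u a = X.length + 1 ∧ v a = Y.length + 1)) :
    ∃ b, 1 ≤ b ∧ b ≤ n ∧ u b = u a ∧ v b = v a ∧ ¬ (u (b + 1) = u b ∧ v (b + 1) = v b) := by
  by_contra hcon
  push Not at hcon
  have key : ∀ b, a ≤ b → b ≤ n + 1 → u b = u a ∧ v b = v a := by
    intro b hb
    induction b, hb using Nat.le_induction with
    | base => intro _; exact ⟨rfl, rfl⟩
    | succ b hb ih =>
      intro hbn
      obtain ⟨h1, h2⟩ := ih (by omega)
      have := hcon b (by omega) (by omega) h1 h2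
      omega
  have := key (n + 1) ha' le_rfl
  rw [hu.2.1, hv.2.1] at this
  exact hend ⟨this.1.symm, this.2.symm⟩

variable [DecidableEq α]

/-- The pair of walks `(u, v)` passes through the point of `(x, y)` at index `t`. -/
def Meets (n : ℕ) (u v x y : ℕ → ℕ) (t : ℕ) : Prop :=
  ∃ b, 1 ≤ b ∧ b ≤ n + 1 ∧ u b = x t ∧ v b = y t

/-- The indices at which `(x, y)` moves away from a point of `(u, v)` that is a break there. -/
noncomputable def sharedBreaks (X Y : List α) (m n : ℕ) (x y u v : ℕ → ℕ) : Finset ℕ := by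
  classical
  exact (Finset.Icc 1 m).filter (fun t => ¬ (x (t + 1) = x t ∧ y (t + 1) = y t) ∧
    ∃ b ∈ breakTimes X Y n u v, u b = x t ∧ v b = y t)

/-- The indices at which `(x, y)` joins `(u, v)`. -/
noncomputable def merges (m n : ℕ) (x y u v : ℕ → ℕ) : Finset ℕ := by
  classical
  exact (Finset.Icc 1 m).filter (fun t => ¬ Meets n u v x y t ∧ Meets n u v x y (t + 1))

theorem mem_sharedBreaks {t : ℕ} : t ∈ sharedBreaks X Y m n x y u v ↔ (1 ≤ t ∧ t ≤ m) ∧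
    ¬ (x (t + 1) = x t ∧ y (t + 1) = y t) ∧
    ∃ b ∈ breakTimes X Y n u v, u b = x t ∧ v b = y t := by
  rw [sharedBreaks, Finset.mem_filter, Finset.mem_Icc]

theorem mem_merges {t : ℕ} : t ∈ merges m n x y u v ↔ (1 ≤ t ∧ t ≤ m) ∧
    ¬ Meets n u v x y t ∧ Meets n u v x y (t + 1) := by
  classical
  simp only [merges, Finset.mem_filter, Finset.mem_Icc]

/-- Each break of `(u, v)` determines a point, and `(x, y)` leaves that point at most once. -/
theorem card_sharedBreaks_le (hx : IsCompleteWalk m X x) (hy : IsCompleteWalk m Y y) :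
    (sharedBreaks X Y m n x y u v).card ≤ (breakTimes X Y n u v).card := by
  refine Finset.card_le_card_of_forall_subsingleton (fun t b => u b = x t ∧ v b = y t) ?_ ?_
  · intro t ht
    exact (mem_sharedBreaks.1 ht).2.2
  · rintro b - t ⟨ht, h1, h2⟩ t' ⟨ht', h1', h2'⟩
    have a := mem_sharedBreaks.1 (Finset.mem_coe.1 ht)
    have a' := mem_sharedBreaks.1 (Finset.mem_coe.1 ht')
    rcases lt_trichotomy t t' with h | h | h
    · exact absurd (eq_of_eq_later hx hy a.1.1 h (by omega) (by omega) (by omega)) a.2.1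
    · exact h
    · exact absurd (eq_of_eq_later hx hy a'.1.1 h (by omega) (by omega) (by omega)) a'.2.1

/-- At a common point that is not a break of `(u, v)`, a greedy pair of walks follows `(u, v)`. -/
theorem follows_of_meets (hx : IsCompleteWalk m X x) (hy : IsCompleteWalk m Y y)
    (hu : IsCompleteWalk n X u) (hv : IsCompleteWalk n Y v)
    (hg : ∀ t ∈ breakTimes X Y m x y, ¬ SameChar X Y (x t, y t)) {t : ℕ} (ht : 1 ≤ t)
    (ht' : t ≤ m) (hmeet : Meets n u v x y t) (hnot : t ∉ sharedBreaks X Y m n x y u v) :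
    t ∉ breakTimes X Y m x y ∧ Meets n u v x y (t + 1) := by
  by_cases hmove : x (t + 1) = x t ∧ y (t + 1) = y t
  · refine ⟨fun h => (mem_breakTimes.1 h).2.1 hmove, ?_⟩
    rw [Meets, hmove.1, hmove.2]
    exact hmeet
  obtain ⟨b, b1, b2, b3, b4⟩ := hmeet
  have c1 := hx.mono (a := t) (b := t + 1) ht (by omega) (by omega)
  have c2 := hy.mono (a := t) (b := t + 1) ht (by omega) (by omega)
  have c3 := hx.le_length (a := t + 1) (by omega) (by omega)
  have c4 := hy.le_length (a := t + 1) (by omega) (by omega)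
  obtain ⟨d, d1, d2, d3, d4, d5⟩ := exists_move hu hv b1 b2 (by
    rintro ⟨e1, e2⟩
    exact hmove ⟨by omega, by omega⟩)
  rcases step_of_notMem_breakTimes d1 d2 (fun hd => hnot (mem_sharedBreaks.2
    ⟨⟨ht, ht'⟩, hmove, d, hd, by omega, by omega⟩)) with h | h
  · exact absurd h d5
  · have hs : SameChar X Y (x t, y t) := by
      rw [← b3, ← b4, ← d3, ← d4]; exact h.2.2
    have hnb : t ∉ breakTimes X Y m x y := fun hb => hg t hb hs
    refine ⟨hnb, ?_⟩
    rcases step_of_notMem_breakTimes ht ht' hnb with h' | h'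
    · exact absurd h' hmove
    · exact ⟨d + 1, by omega, by omega, by omega, by omega⟩

/-- The pairs start together, so each merge is preceded by its own separation, and separations occur
only at shared breaks. -/
theorem card_merges_le (hx : IsCompleteWalk m X x) (hy : IsCompleteWalk m Y y)
    (hu : IsCompleteWalk n X u) (hv : IsCompleteWalk n Y v)
    (hg : ∀ t ∈ breakTimes X Y m x y, ¬ SameChar X Y (x t, y t)) :
    (merges m n x y u v).card ≤ (sharedBreaks X Y m n x y u v).card := by
  classical
  refine (card_rise_le_card_fall (P := Meets n u v x y)
    ⟨1, le_rfl, by omega, by rw [hu.1, hx.1], by rw [hv.1, hy.1]⟩ m |> le_trans (le_of_eq ?_)).trans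
    (Finset.card_le_card ?_)
  · congr 1
  · intro t ht
    rw [Finset.mem_filter, Finset.mem_Icc] at ht
    by_contra hcon
    exact ht.2.2 (follows_of_meets hx hy hu hv hg ht.1.1 ht.1.2 ht.2.1 hcon).2

/-- The index `τ` lies in the neighbourhood of the stored index `t`. -/
def Near (k : ℕ) (X : List α) (m : ℕ) (x : ℕ → ℕ) (t τ : ℕ) : Prop :=
  lastStored k X m x t ≤ τ + 1 ∧ τ < (nxt k X m x)^[3] t

/-- The stored indices at which the context encodings differ. -/
def storedDifferences (k : ℕ) (X Y : List α) (m : ℕ) (x y : ℕ → ℕ) : Finset ℕ :=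
  (Finset.Icc 1 m).filter
    (fun t => Stored k X m x t ∧ contextSymbol k X m x t ≠ contextSymbol k Y m y t)

theorem lastStored_le {t : ℕ} : lastStored k X m x t ≤ t :=
  (Nat.findGreatest_le (P := fun u => Stored k X m x u) (t - 1)).trans (Nat.sub_le _ _)

/-- A neighbourhood of a difference without shared breaks and merges contains many breaks. -/
theorem le_card_breaks_near (hx : IsCompleteWalk m X x) (hy : IsCompleteWalk m Y y)
    (hu : IsCompleteWalk n X u) (hv : IsCompleteWalk n Y v)
    (hg : ∀ t ∈ breakTimes X Y m x y, ¬ SameChar X Y (x t, y t))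
    (hw : ∀ t, 1 ≤ t → t ≤ m + 1 → x t ≤ y t + w ∧ y t ≤ x t + w)
    (hcost : (breakTimes X Y n u v).card ≤ k) (hk : 1 ≤ k) (hk' : w + 5 * k ≤ k') {t : ℕ}
    (ht : t ∈ storedDifferences k' X Y m x y)
    (hno : ∀ τ, Near k' X m x t τ → τ ∉ sharedBreaks X Y m n x y u v ∧ τ ∉ merges m n x y u v)
    {B : Finset ℕ} (hB : ∀ τ, τ ∈ breakTimes X Y m x y → Near k' X m x t τ → τ ∈ B) :
    k ≤ B.card := by
  have hone : 1 ≤ k' := by omega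
  rw [storedDifferences, Finset.mem_filter, Finset.mem_Icc] at ht
  obtain ⟨⟨t1, t2⟩, hst, hdiff⟩ := ht
  have hxt := hst.2.1
  have hlast : lastStored k' X m x t ≤ t := lastStored_le
  have hit := nxt_iterate_mem hx hone 3 t1 (by omega : t ≤ m + 1)
  obtain ⟨τ₀, n1, n2, hτ₀⟩ : ∃ τ, lastStored k' X m x t ≤ τ + 1 ∧ τ < (nxt k' X m x)^[3] t ∧
      τ ∈ breakTimes X Y m x y := by
    by_contra hcon
    push Not at hcon
    exact hdiff (contextSymbol_congr hx hy hone (by omega) hst hcon)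
  have hτ₁ := (mem_breakTimes.1 hτ₀).1
  -- Without shared breaks a meeting persists forwards, and without merges it persists backwards. It
  -- would reach the break `τ₀`, where `(x, y)` must instead follow `(u, v)` through a match.
  have hoff : ∀ τ, 1 ≤ τ → τ ≤ m → Near k' X m x t τ → ¬ Meets n u v x y τ := by
    intro τ τ1 τ2 τ3 hmeet
    have hτm : Meets n u v x y τ₀ := by
      rcases Nat.le_total τ τ₀ with h | h
      · have key : ∀ b, τ ≤ b → b ≤ τ₀ → Meets n u v x y b := by
          intro b hb
          induction b, hb using Nat.le_induction with
          | base => intro _; exact hmeet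
          | succ b hb ih =>
            intro hb'
            exact (follows_of_meets hx hy hu hv hg (by omega) (by omega) (ih (by omega))
              (hno b ⟨by have := τ3.1; omega, by omega⟩).1).2
        exact key τ₀ h le_rfl
      · have key : ∀ b, τ₀ ≤ b → b ≤ τ → Meets n u v x y b → Meets n u v x y τ₀ := by
          intro b hb
          induction b, hb using Nat.le_induction with
          | base => intro _ h; exact h
          | succ b hb ih =>
            intro hb' hmb
            refine ih (by omega) ?_
            by_contra hcon
            exact (hno b ⟨by omega, by have := τ3.2; omega⟩).2
              (mem_merges.2 ⟨⟨by omega, by omega⟩, hcon, hmb⟩)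
        exact key τ h le_rfl hmeet
    exact (follows_of_meets hx hy hu hv hg hτ₁.1 hτ₁.2 hτm (hno τ₀ ⟨n1, n2⟩).1).1 hτ₀
  set a := nxt k' X m x t with ha
  have a1 := lt_nxt hx hone t1 (by omega) hxt
  have a2 := nxt_le (k := k') hx t1 (by omega)
  rw [← ha] at a1 a2
  have a3 := le_nxt hx hone (t := a) (by omega) a2
  have a4 := nxt_le (k := k') hx (t := a) (by omega) a2
  have a5 : nxt k' X m x a ≤ (nxt k' X m x)^[3] t := le_nxt hx hone (by omega) a4
  have b1 := hx.one_le t1 (by omega)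
  have b3 : x a = ctxEnd k' X (x t) := apply_nxt hx t1 (by omega) hxt
  have hnear : ∀ τ, t ≤ τ → τ < nxt k' X m x a → Near k' X m x t τ :=
    fun τ h1 h2 => ⟨by omega, by omega⟩
  -- If the context reached the end of `X`, the last step, into the common endpoint of all
  -- alignments, would be a merge.
  have hend : x a ≤ X.length := by
    by_contra hcon
    have e : nxt k' X m x a = m + 1 := by rw [nxt, if_neg hcon]
    have hm := hnear m t2 (by omega)
    refine (hno m hm).2 (mem_merges.2 ⟨⟨by omega, le_rfl⟩, hoff m (by omega) le_rfl hm, ?_⟩)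
    exact ⟨n + 1, by omega, le_rfl, by rw [hu.2.1, hx.2.1], by rw [hv.2.1, hy.2.1]⟩
  have c1 := apply_nxt (k := k') hx (t := a) (by omega) a2 hend
  have c2 := lt_ctxEnd (S := X) hone (p := x a) (hx.one_le (by omega) a2) hend
  have hwin : ∀ τ, 1 ≤ τ → τ ≤ m + 1 → x t < x τ → x τ < x a + 1 →
      τ ≤ m ∧ Near k' X m x t τ := by
    intro τ τ1 τ2 τ3 τ4
    have d1 : t ≤ τ := by
      by_contra hcon
      have := hx.mono τ1 (not_le.1 hcon).le (by omega)
      omega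
    have d2 : τ < nxt k' X m x a := by
      by_contra hcon
      have := hx.mono (by omega) (not_lt.1 hcon) τ2
      omega
    exact ⟨by omega, hnear τ d1 d2⟩
  have hsimple := isSimple_of_disjoint hx hy hu hv (p := x t) (r := x a + 1) b1 (by omega) hw hcost
    (by
      intro τ τ1 τ2 τ3 τ4 b b1 b2 hb
      obtain ⟨d1, d2⟩ := hwin τ τ1 τ2 τ3 τ4
      exact hoff τ τ1 d1 d2 ⟨b, b1, b2, hb⟩)
  have hcard : (breakTimesIn X Y m x y (x t) (x a + 1)).card ≤ B.card := by
    apply Finset.card_le_card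
    intro τ hτ
    obtain ⟨h1, h2, h3⟩ := Finset.mem_filter.1 hτ
    have h4 := (mem_breakTimes.1 h1).1
    exact hB τ h1 (hwin τ h4.1 (by omega) h2 h3).2
  by_contra hcon
  -- With at most `k - 1` breaks the bound is `w + 3k + 2(k - 1) + 2 = w + 5k ≤ k'`, so the context
  -- could be extended by one character.
  refine not_isSimple_of_ctxEnd (k := k') (S := X) b1 (by omega) ?_
  rw [← b3]
  exact fun l r h1 h2 h3 => (hsimple l r h1 h2 h3).trans (by omega)

/-- The number of stored indices at which the context encodings differ. -/
theorem card_storedDifferences_mul_le (hx : IsCompleteWalk m X x) (hy : IsCompleteWalk m Y y)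
    (hu : IsCompleteWalk n X u) (hv : IsCompleteWalk n Y v)
    (hg : ∀ t ∈ breakTimes X Y m x y, ¬ SameChar X Y (x t, y t))
    (hw : ∀ t, 1 ≤ t → t ≤ m + 1 → x t ≤ y t + w ∧ y t ≤ x t + w)
    (hcost : (breakTimes X Y n u v).card ≤ k) (hk : 1 ≤ k) (hk' : w + 5 * k ≤ k') :
    (storedDifferences k' X Y m x y).card * k ≤
      (2 * k * k + (breakTimes X Y m x y).card) * (3 * (Nat.log 2 m + 1) + 2) := by
  classical
  set T := storedDifferences k' X Y m x y with hT
  set K := 3 * (Nat.log 2 m + 1) + 2 with hK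
  set E := sharedBreaks X Y m n x y u v ∪ merges m n x y u v with hE
  have hEcard : E.card ≤ 2 * k := by
    have h1 : E.card ≤ _ := Finset.card_union_le (sharedBreaks X Y m n x y u v) (merges m n x y u v)
    have h2 := card_sharedBreaks_le (n := n) (u := u) (v := v) hx hy
    have h3 := card_merges_le hx hy hu hv hg
    omega
  have hmult : ∀ (T' : Finset ℕ) (τ : ℕ), T' ⊆ T →
      (T'.bipartiteBelow (Near k' X m x) τ).card ≤ K := by
    intro T' τ hsub
    refine (Finset.card_le_card ?_).trans
      (card_stored_neighbourhood_le hx (by omega : 1 ≤ k') τ)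
    intro t ht
    rw [Finset.mem_bipartiteBelow] at ht
    have h1 := hsub ht.1
    rw [hT, storedDifferences, Finset.mem_filter] at h1
    exact Finset.mem_filter.2 ⟨h1.1, h1.2.1, ht.2⟩
  set T₁ := T.filter (fun t => ∃ τ ∈ E, Near k' X m x t τ) with hT₁
  set T₂ := T.filter (fun t => ¬ ∃ τ ∈ E, Near k' X m x t τ) with hT₂
  -- Double counting of `Near`: a difference in `T₁` sees at least one event of `E`, one in `T₂` at
  -- least `k` breaks, and every index is near at most `K` differences.
  have h1 : T₁.card * 1 ≤ E.card * K := by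
    refine Finset.card_mul_le_card_mul (Near k' X m x) ?_
      (fun τ _ => hmult T₁ τ (Finset.filter_subset _ _))
    intro t ht
    obtain ⟨-, τ, h1, h2⟩ := Finset.mem_filter.1 ht
    exact Finset.card_pos.2 ⟨τ, (Finset.mem_bipartiteAbove _).2 ⟨h1, h2⟩⟩
  have h2 : T₂.card * k ≤ (breakTimes X Y m x y).card * K := by
    refine Finset.card_mul_le_card_mul (Near k' X m x) ?_
      (fun τ _ => hmult T₂ τ (Finset.filter_subset _ _))
    intro t ht
    obtain ⟨h1, h2⟩ := Finset.mem_filter.1 ht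
    refine le_card_breaks_near hx hy hu hv hg hw hcost hk hk' h1 ?_ ?_
    · intro τ h3
      constructor
      · exact fun h4 => h2 ⟨τ, Finset.mem_union_left _ h4, h3⟩
      · exact fun h4 => h2 ⟨τ, Finset.mem_union_right _ h4, h3⟩
    · exact fun τ h3 h4 => (Finset.mem_bipartiteAbove _).2 ⟨h3, h4⟩
  have h3 : T₁.card + T₂.card = T.card := Finset.card_filter_add_card_filter_not _
  have h4 : E.card * K ≤ 2 * k * K := Nat.mul_le_mul_right _ hEcard
  have h5 : T₁.card * k ≤ 2 * k * K * k := Nat.mul_le_mul_right _ (by omega)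
  rw [← h3, Nat.add_mul]
  calc T₁.card * k + T₂.card * k ≤ 2 * k * K * k + (breakTimes X Y m x y).card * K :=
        Nat.add_le_add h5 h2
    _ = _ := by ring

/-- Where the symbols differ, at least one of the walks stores an entry. The two cases are
symmetric, which costs a factor of two. -/
theorem hammingDist_le :
    hammingDist (contextEncoding k' X m x) (contextEncoding k' Y m y) ≤
      (storedDifferences k' X Y m x y).card + (storedDifferences k' Y X m y x).card := by
  classical
  refine le_trans ?_ (Finset.card_union_le _ _)
  rw [hammingDist]
  refine Finset.card_le_card_of_injOn (fun j : Fin m => (j : ℕ) + 1) ?_ ?_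
  · intro j hj
    have hne : contextSymbol k' X m x (j + 1) ≠ contextSymbol k' Y m y (j + 1) :=
      (Finset.mem_filter.1 (Finset.mem_coe.1 hj)).2
    have hmem : (j : ℕ) + 1 ∈ Finset.Icc 1 m := Finset.mem_Icc.2 ⟨by omega, j.2⟩
    rw [Finset.mem_coe, Finset.mem_union, storedDifferences, storedDifferences, Finset.mem_filter,
      Finset.mem_filter]
    by_cases h1 : Stored k' X m x (j + 1)
    · exact Or.inl ⟨hmem, h1, hne⟩
    · by_cases h2 : Stored k' Y m y (j + 1)
      · exact Or.inr ⟨hmem, h2, hne.symm⟩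
      · exact absurd (by rw [contextSymbol, contextSymbol, if_neg h1, if_neg h2]) hne
  · intro j _ j' _ h
    exact Fin.ext (Nat.succ_injective h)

/-- A bound on the Hamming distance of the context encodings. -/
theorem hammingDist_mul_le (hx : IsCompleteWalk m X x) (hy : IsCompleteWalk m Y y)
    (hg : IsGreedy X Y (zipAlignment m x y)) (hk : 1 ≤ k) (hed : editDist X Y ≤ k)
    (hk' : width (zipAlignment m x y) + 5 * k ≤ k') :
    hammingDist (contextEncoding k' X m x) (contextEncoding k' Y m y) * k ≤
      2 * ((2 * k * k + cost X Y (zipAlignment m x y)) * (3 * (Nat.log 2 m + 1) + 2)) := by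
  have hW := (zipAlignment_spec hx hy).2
  have hgW : ∀ t ∈ breakTimes X Y m x y, ¬ SameChar X Y (x t, y t) :=
    fun t ht => not_sameChar_of_isGreedy hx hy hW hg ht
  obtain ⟨n, u, v, hu, hv, hcost⟩ := exists_walks_of_editDist_le hx hy hed
  have h1 := card_storedDifferences_mul_le hx hy hu hv hgW
    (fun t a b => dist_le_width hx hy a b) hcost hk hk'
  have h2 := card_storedDifferences_mul_le (k' := k') hy hx hv hu
    (fun t ht h => hgW t (by rwa [breakTimes_swap] at ht) (sameChar_swap_iff.1 h))
    (fun t a b => (dist_le_width hx hy a b).symm) (by rwa [breakTimes_swap]) hk hk'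
  rw [breakTimes_swap] at h2
  have h3 : (2 * k * k + (breakTimes X Y m x y).card) * (3 * (Nat.log 2 m + 1) + 2) ≤
      (2 * k * k + cost X Y (zipAlignment m x y)) * (3 * (Nat.log 2 m + 1) + 2) :=
    Nat.mul_le_mul_right _ (Nat.add_le_add_left (card_breakTimes_le_cost hx hy hW) _)
  have h4 := Nat.mul_le_mul_right k (hammingDist_le (X := X) (Y := Y) (m := m) (k' := k') (x := x) (y := y))
  rw [Nat.add_mul] at h4
  omega

/-- With `L = Nat.log 2 m ≥ 1` the left side is `3L + 5 ≤ 8L`, and `L / 2 ≤ L log 2 ≤ log m`. -/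
theorem log_two_bound {m : ℕ} (hm : 2 ≤ m) :
    ((3 * (Nat.log 2 m + 1) + 2 : ℕ) : ℝ) ≤ 16 * Real.log m := by
  have h1 : 1 ≤ Nat.log 2 m := Nat.log_pos (by norm_num) hm
  have h2 : ((2 : ℕ) : ℝ) ^ Nat.log 2 m ≤ m := by
    exact_mod_cast Nat.pow_log_le_self 2 (by omega)
  have h3 := Real.log_le_log (by positivity) h2
  rw [Real.log_pow] at h3
  have h4 : (1 / 2 : ℝ) < Real.log 2 := by
    have := Real.log_two_gt_d9; linarith
  have h5 : (1 : ℝ) ≤ Nat.log 2 m := by exact_mod_cast h1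
  push_cast at h3 ⊢
  nlinarith

end Counting

end WalkEnc

theorem mainTheorem10 :
    ∃ c : ℝ, 0 < c ∧
      ∀ (α : Type*) [DecidableEq α] (X Y : List α) (m : ℕ) (x y : ℕ → ℕ) (k' : ℕ),
        1 ≤ k' →
        IsCompleteWalk m X x → IsCompleteWalk m Y y →
        IsGreedy X Y (zipAlignment m x y) →
        breakPositions X Y (zipAlignment m x y) ⊆ revealed k' X Y m x y ∧
        ∀ k : ℕ, 1 ≤ k → editDist X Y ≤ k →
          width (zipAlignment m x y) + 5 * k ≤ k' →
          (∀ A ∈ greedyAlignments k X Y,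
            divergence X Y A (zipAlignment m x y) ⊆ revealed k' X Y m x y) ∧
          (2 ≤ m →
            (hammingDist (contextEncoding k' X m x) (contextEncoding k' Y m y) : ℝ) ≤
              c * ((k : ℝ) + (cost X Y (zipAlignment m x y) : ℝ) / (k : ℝ)) * Real.log m) := by
  -- The constant is `2 * 2 * 16`: both orders of the walks, at most `2k` events, and the factor
  -- from `log_two_bound`.
  refine ⟨64, by norm_num, ?_⟩
  intro α _ X Y m x y k' hone hx hy hg
  refine ⟨breakPositions_subset_revealed hx hy hone hg, fun k hk hed hk' =>
    ⟨fun A hA => divergence_subset_revealed hx hy hg hk hk' hA, fun hm => ?_⟩⟩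
  have h1 := hammingDist_mul_le hx hy hg hk hed hk'
  have h2 := log_two_bound hm
  have hkpos : (0 : ℝ) < k := by exact_mod_cast hk
  set K := 3 * (Nat.log 2 m + 1) + 2
  set C := cost X Y (zipAlignment m x y)
  have h3 : (hammingDist (contextEncoding k' X m x) (contextEncoding k' Y m y) : ℝ) * k ≤
      2 * ((2 * k * k + C) * (K : ℝ)) := by exact_mod_cast h1
  rw [← mul_le_mul_iff_of_pos_right hkpos]
  have hC : (0 : ℝ) ≤ C := Nat.cast_nonneg _
  have hlog : 0 ≤ Real.log m := Real.log_natCast_nonneg m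
  calc (hammingDist (contextEncoding k' X m x) (contextEncoding k' Y m y) : ℝ) * k
      ≤ 2 * ((2 * k * k + C) * (K : ℝ)) := h3
    _ ≤ 2 * ((2 * k * k + C) * (16 * Real.log m)) := by gcongr
    _ ≤ 64 * (k * k + C) * Real.log m := by nlinarith [mul_nonneg hC hlog]
    _ = 64 * ((k : ℝ) + C / k) * Real.log m * k := by field_simp
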